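/- Let $n\ge 0$, $\hat{\mathcal O}=\mathbb C[[x_1,\dots,x_n]]$, $\mathcal U_{\rm loc}=\{u\in\mathbb R^n : u_i\ge 0 \text{ for all } i\}$, and for $\lambda\subseteq\{1,\dots,n\}$ let $\mathcal U^\lambda_{\rm loc}=\{u : u_i=0 \text{ for } i\in\lambda,\ u_i>0 \text{ for } i\notin\lambda\}$. For $f=\sum_\alpha p_\alpha x^\alpha\in\hat{\mathcal O}$ put $\mathrm{Supp}(f)=\{\alpha : p_\alpha\ne0\}$. For $w\in\mathcal U_{\rm loc}$ let $F^w_k$ (resp. $F^w_{>k}$) be the space of series all of whose terms have $w$-weight $w\cdot\alpha\ge k$ (resp. $>k$), $\mathrm{Gr}^w(\hat{\mathcal O})=\bigoplus_{k}F^w_k/F^w_{>k}$, and let $\mathrm{in}_w(f)$ be the class of $f$ in $F^w_k/F^w_{>k}$, where $k=\min\{w\cdot\alpha:\alpha\in\mathrm{Supp}(f)\}$ (and $\mathrm{in}_w(0)=0$). A monomial of $\mathrm{Gr}^w(\hat{\mathcal O})$ is the class of some $c\,x^\alpha$ with $c\in\mathbb C\setminus\{0\}$. Let $\mathcal T^h_{\rm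 loc}(\mathrm{trop}(f))$ be the set of $w\in\mathcal U_{\rm loc}$ at which $\min\{w\cdot\alpha:\alpha\in\mathrm{Supp}(f)\}$ is attained at least twice; for $f=0$ it is by convention $\mathcal U_{\rm loc}$. For $\lambda\subseteq\{1,\dots,n\}$ let $\phi_\lambda(f)$ be $f$ regarded as a power series in the variables $x_i$, $i\notin\lambda$, with coefficients in the ring of power series in the $x_i$, $i\in\lambda$, and let $E(\phi_\lambda(f))$ be the smallest subset $E$ of $\mathrm{Supp}(\phi_\lambda(f))$ with $E+\mathbb N^{\lambda^c}=\mathrm{Supp}(\phi_\lambda(f))+\mathbb N^{\lambda^c}$; this is the finite set of the minimal exponents of $\phi_\lambda(f)$. Let $E_\lambda(f)$ be the set of the $\alpha\in\mathrm{Supp}(f)$ whose projection to $\mathbb N^{\lambda^c}$ lies in $E(\phi_\lambda(f))$. Let $A_\lambda(f)\subseteq E_\lambda(f)$ be a (finite) set obtained by choosing, for each $\beta\in E(\phi_\lambda(f))$, two elements of $E_\lambda(f)$ over $\beta$ if there are at least two, and otherwise the only one. Put $\widetilde f^\lambda=\sum_{\alpha\in E_\lambda(f)}p_\alpha x^\alpha\in\hat{\mathcal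 O}$ and $\widehat f^\lambda=\sum_{\alpha\in A_\lambda(f)}p_\alpha x^\alpha\in\mathbb C[x_1,\dots,x_n]$. Let $K=\mathbb C\{\{t\}\}$ be the field of Puiseux series. For $g\in\mathbb C[x_1,\dots,x_n]$ let $V(g)=\{v\in(K\setminus\{0\})^n : g(v)=0\}$, let $\mathrm{ord}:(K\setminus\{0\})^n\to\mathbb Q^n\subset\mathbb R^n$ be the coordinatewise order, and let the bar denote closure in $\mathbb R^n$. **Theorem.** Let $I$ be any ideal of $\hat{\mathcal O}$, and let sets $A_\lambda(f)$ as above be chosen in any way for all $\lambda\subseteq\{1,\dots,n\}$ and $f\in I$. Then the following five subsets of $\mathcal U_{\rm loc}$ coincide: 1. $\{w\in\mathcal U_{\rm loc} : \text{for every } f\in I,\ \mathrm{in}_w(f)\in\mathrm{Gr}^w(\hat{\mathcal O}) \text{ is not a monomial}\}$; 2. $\bigcap_{f\in I}\mathcal T^h_{\rm loc}(\mathrm{trop}(f))$; 3. $\bigcup_{\lambda}\bigl(\bigl(\bigcap_{f\in I}\mathcal T^h_{\rm loc}(\mathrm{trop}(\widetilde f^\lambda))\bigr)\cap\mathcal U^\lambda_{\rm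 loc}\bigr)$; 4. $\bigcup_{\lambda}\bigl(\bigl(\bigcap_{f\in I}\mathcal T^h_{\rm loc}(\mathrm{trop}(\widehat f^\lambda))\bigr)\cap\mathcal U^\lambda_{\rm loc}\bigr)$; 5. $\bigcup_{\lambda}\bigl(\bigl(\bigcap_{f\in I}\overline{\mathrm{ord}(V(\widehat f^\lambda))}\bigr)\cap\mathcal U^\lambda_{\rm loc}\bigr)$. The last set is the local tropical variety $\mathcal T_{\rm loc}(I)$. Moreover, if $I$ contains no monomial $c\,x^\alpha$ with $c\neq0$, then the five sets also coincide under the convention that $\widetilde f^\lambda=\widehat f^\lambda=0$ for $\lambda=\{1,\dots,n\}$ and all $f$ (the truncations for the other $\lambda$ being unchanged). -/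

import Mathlib

open scoped DirectSum

noncomputable section

namespace LocalTropical

/-! ### Weights, strata, supports -/

/-- The closed orthant `U_loc` of local weights. -/
def ULoc (n : ℕ) : Set (Fin n → ℝ) := {u | ∀ i, 0 ≤ u i}

/-- The stratum of `U_loc` of the weights vanishing exactly on the coordinates in `lam`
(so `lam = ∅` is the maximal stratum and `lam = univ` is the origin). -/
def stratum {n : ℕ} (lam : Finset (Fin n)) : Set (Fin n → ℝ) :=
  {u | (∀ i ∈ lam, u i = 0) ∧ ∀ i ∉ lam, 0 < u i}

/-- The scalar product of a weight and an exponent. -/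
def dotExp {n : ℕ} (w : Fin n → ℝ) (α : Fin n →₀ ℕ) : ℝ := ∑ i, w i * (α i : ℝ)

/-- The support of a formal power series. -/
def supp {σ R : Type*} [Semiring R] (f : MvPowerSeries σ R) : Set (σ →₀ ℕ) :=
  {α | MvPowerSeries.coeff α f ≠ 0}

/-! ### The associated graded module and initial forms -/

/-- `F_k^w`, the series all of whose terms have `w`-weight at least `k`. -/
def filt {n : ℕ} (w : Fin n → ℝ) (k : ℝ) : Submodule ℂ (MvPowerSeries (Fin n) ℂ) where
  carrier := {f | ∀ α ∈ supp f, k ≤ dotExp w α}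
  zero_mem' := fun α h => absurd (map_zero _) h
  add_mem' := by
    intro f g hf hg α hα
    by_contra hk
    have h1 : MvPowerSeries.coeff α f = 0 := by
      by_contra h
      exact hk (hf α h)
    have h2 : MvPowerSeries.coeff α g = 0 := by
      by_contra h
      exact hk (hg α h)
    exact hα (by rw [map_add, h1, h2, add_zero])
  smul_mem' := by
    intro c f hf α hα
    refine hf α fun h => hα ?_
    rw [MvPowerSeries.coeff_smul, h, mul_zero]

/-- `F_{>k}^w`, the series all of whose terms have `w`-weight greater than `k`. -/
def filtGT {n : ℕ} (w : Fin n → ℝ) (k : ℝ) : Submodule ℂ (MvPowerSeries (Fin n) ℂ) where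
  carrier := {f | ∀ α ∈ supp f, k < dotExp w α}
  zero_mem' := fun α h => absurd (map_zero _) h
  add_mem' := by
    intro f g hf hg α hα
    by_contra hk
    have h1 : MvPowerSeries.coeff α f = 0 := by
      by_contra h
      exact hk (hf α h)
    have h2 : MvPowerSeries.coeff α g = 0 := by
      by_contra h
      exact hk (hg α h)
    exact hα (by rw [map_add, h1, h2, add_zero])
  smul_mem' := by
    intro c f hf α hα
    refine hf α fun h => hα ?_
    rw [MvPowerSeries.coeff_smul, h, mul_zero]

/-- The graded piece `F_k^w / F_{>k}^w`. -/
abbrev GrPiece {n : ℕ} (w : Fin n → ℝ) (k : ℝ) : Type :=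
  filt w k ⧸ (filtGT w k).submoduleOf (filt w k)

/-- `Gr^w`, the direct sum of the pieces `F_k^w / F_{>k}^w`. -/
abbrev Gr {n : ℕ} (w : Fin n → ℝ) : Type := ⨁ k : ℝ, GrPiece w k

/-- The `w`-weight of a nonzero series: the least `w`-weight of its terms, a minimum that is
attained for `w ∈ U_loc`. (The value at `f = 0` is irrelevant, since the class of `0` is `0`
in every graded piece.) -/
def wei {n : ℕ} (w : Fin n → ℝ) (f : MvPowerSeries (Fin n) ℂ) : ℝ :=
  sInf (dotExp w '' supp f)

theorem mem_filt_wei {n : ℕ} {w : Fin n → ℝ} (hw : w ∈ ULoc n)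
    (f : MvPowerSeries (Fin n) ℂ) : f ∈ filt w (wei w f) := by
  intro α hα
  refine csInf_le ⟨0, ?_⟩ ⟨α, hα, rfl⟩
  rintro _ ⟨β, -, rfl⟩
  exact Finset.sum_nonneg fun i _ => mul_nonneg (hw i) (Nat.cast_nonneg _)

/-- The initial form `in_w(f)`: the class of `f` in `F_k^w / F_{>k}^w`, where `k` is the
weight of `f`. -/
def initialForm {n : ℕ} (w : ULoc n) (f : MvPowerSeries (Fin n) ℂ) : Gr w.1 :=
  DirectSum.of (fun k : ℝ => GrPiece w.1 k) (wei w.1 f)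
    (Submodule.Quotient.mk ⟨f, mem_filt_wei w.2 f⟩)

/-- The monomials of `Gr^w` are the classes of the `c x^α`, `c ≠ 0`. -/
def IsGrMonomial {n : ℕ} (w : ULoc n) (g : Gr w.1) : Prop :=
  ∃ (α : Fin n →₀ ℕ) (c : ℂ), c ≠ 0 ∧ g = initialForm w (MvPowerSeries.monomial α c)

/-! ### Tropicalization -/

/-- Formal (infinite) tropical sums of tropical monomials over `(ℝ ∪ {∞}, min, +)`. -/
abbrev TropSeries (n : ℕ) : Type := MvPowerSeries (Fin n) (Tropical (WithTop ℝ))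

open Classical in
/-- `trop(f)`: nonzero complex coefficients have order `0`, the tropical unit; the
coefficient `0` has order `∞`, the tropical zero. -/
def trop {n : ℕ} (f : MvPowerSeries (Fin n) ℂ) : TropSeries n :=
  fun α => if MvPowerSeries.coeff α f = 0 then 0 else 1

/-- The value at `w` of the term of exponent `α` of a tropical series. -/
def tropTerm {n : ℕ} (F : TropSeries n) (w : Fin n → ℝ) (α : Fin n →₀ ℕ) :
    Tropical (WithTop ℝ) :=
  MvPowerSeries.coeff α F * ∏ i, Tropical.trop ((w i : ℝ) : WithTop ℝ) ^ α i

/-- The local tropical hypersurface: the local weights at which the minimum of the terms is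
attained at least twice. By convention it is all of `U_loc` for the empty tropical sum. -/
def tropHypersurface {n : ℕ} (F : TropSeries n) : Set (Fin n → ℝ) :=
  {w | w ∈ ULoc n ∧ (F = 0 ∨ ∃ α β : Fin n →₀ ℕ, α ≠ β ∧ tropTerm F w α = tropTerm F w β ∧
    ∀ γ, tropTerm F w α ≤ tropTerm F w γ)}

/-! ### Truncations -/

/-- The minimal exponents of `g`. By the three lemmas below, this is the unique minimal
subset `E` of `Supp(g)` with `E + ℕ^σ = Supp(g) + ℕ^σ`, and it is finite. -/
def minExp {σ R : Type*} [Semiring R] (g : MvPowerSeries σ R) : Set (σ →₀ ℕ) :=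
  {β | Minimal (· ∈ supp g) β}

theorem minExp_add {σ R : Type*} [Finite σ] [Semiring R] (g : MvPowerSeries σ R) :
    {δ : σ →₀ ℕ | ∃ β ∈ minExp g, ∃ γ, δ = β + γ} = {δ | ∃ β ∈ supp g, ∃ γ, δ = β + γ} := by
  ext δ
  constructor
  · rintro ⟨β, hβ, γ, rfl⟩
    exact ⟨β, hβ.1, γ, rfl⟩
  · rintro ⟨β, hβ, γ, rfl⟩
    obtain ⟨μ, hμβ, hμ⟩ := exists_minimal_le_of_wellFoundedLT (· ∈ supp g) β hβ
    refine ⟨μ, hμ, (β - μ) + γ, ?_⟩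
    rw [← add_assoc, add_tsub_cancel_of_le hμβ]

theorem minExp_least {σ R : Type*} [Semiring R] (g : MvPowerSeries σ R)
    (E : Set (σ →₀ ℕ)) (hE : E ⊆ supp g)
    (h : {δ : σ →₀ ℕ | ∃ β ∈ E, ∃ γ, δ = β + γ} = {δ | ∃ β ∈ supp g, ∃ γ, δ = β + γ}) :
    minExp g ⊆ E := by
  intro β hβ
  have : β ∈ {δ : σ →₀ ℕ | ∃ β ∈ E, ∃ γ, δ = β + γ} := by
    rw [h]
    exact ⟨β, hβ.1, 0, (add_zero _).symm⟩
  obtain ⟨μ, hμ, γ, hγ⟩ := this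
  have hle : μ ≤ β := by
    rw [hγ]
    exact le_self_add
  have := le_antisymm (hβ.2 (hE hμ) hle) hle
  rwa [this]

theorem minExp_finite {σ R : Type*} [Finite σ] [Semiring R] (g : MvPowerSeries σ R) :
    (minExp g).Finite :=
  (setOfPred_minimal_antichain _).finite_of_partiallyWellOrderedOn
    (Set.isPWO_of_wellQuasiOrderedLE _)

/-- `φ_lam(f)`: the series `f`, read as a power series in the variables outside `lam` over
the ring of power series in the variables of `lam`. -/
def phi {n : ℕ} (lam : Finset (Fin n)) (f : MvPowerSeries (Fin n) ℂ) :
    MvPowerSeries {i : Fin n // ¬ i ∈ lam} (MvPowerSeries {i : Fin n // i ∈ lam} ℂ) :=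
  fun β γ => MvPowerSeries.coeff (Finsupp.piecewise γ β) f

/-- The projection of exponents to the variables outside `lam`. -/
def proj {n : ℕ} (lam : Finset (Fin n)) (α : Fin n →₀ ℕ) :
    {i : Fin n // ¬ i ∈ lam} →₀ ℕ :=
  Finsupp.subtypeDomain (fun i => ¬ i ∈ lam) α

/-- The part of `Supp(f)` lying over the exponent `β` of the variables outside `lam`. -/
def fiber {n : ℕ} (lam : Finset (Fin n)) (f : MvPowerSeries (Fin n) ℂ)
    (β : {i : Fin n // ¬ i ∈ lam} →₀ ℕ) : Set (Fin n →₀ ℕ) :=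
  {α ∈ supp f | proj lam α = β}

/-- `E_lam(f)`, the part of `Supp(f)` lying over the minimal exponents of `φ_lam(f)`. -/
def expSet {n : ℕ} (lam : Finset (Fin n)) (f : MvPowerSeries (Fin n) ℂ) :
    Set (Fin n →₀ ℕ) :=
  {α ∈ supp f | proj lam α ∈ minExp (phi lam f)}

open Classical in
/-- `f̃^lam`, the sum of the terms of `f` with exponent in `E_lam(f)`. -/
def tilde {n : ℕ} (lam : Finset (Fin n)) (f : MvPowerSeries (Fin n) ℂ) :
    MvPowerSeries (Fin n) ℂ :=
  fun α => if α ∈ expSet lam f then MvPowerSeries.coeff α f else 0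

/-- `A` is an admissible choice of `A_lam(f)`: a subset of `E_lam(f)` with two elements over
each minimal exponent whose fibre has at least two elements, and one over the others. -/
def IsSelection {n : ℕ} (lam : Finset (Fin n)) (f : MvPowerSeries (Fin n) ℂ)
    (A : Finset (Fin n →₀ ℕ)) : Prop :=
  (A : Set (Fin n →₀ ℕ)) ⊆ expSet lam f ∧
    ∀ β ∈ minExp (phi lam f),
      ((A : Set (Fin n →₀ ℕ)) ∩ fiber lam f β).encard = min 2 (fiber lam f β).encard

theorem exists_isSelection {n : ℕ} (lam : Finset (Fin n)) (f : MvPowerSeries (Fin n) ℂ) :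
    ∃ A, IsSelection lam f A := by
  classical
  have hex : ∀ β, ∃ S ⊆ fiber lam f β, S.encard = min 2 (fiber lam f β).encard := fun β =>
    Set.exists_subset_encard_eq (min_le_right _ _)
  choose S hS hcard using hex
  have hfin : (⋃ β ∈ minExp (phi lam f), S β).Finite := by
    refine (minExp_finite _).biUnion fun β _ => Set.finite_of_encard_le_coe (k := 2) ?_
    rw [hcard]
    exact min_le_left _ _
  refine ⟨hfin.toFinset, ?_, ?_⟩
  · intro α hα
    rw [Set.Finite.coe_toFinset] at hα
    simp only [Set.mem_iUnion] at hα
    obtain ⟨β, hβ, hα⟩ := hα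
    have h := hS β hα
    exact ⟨h.1, by rw [h.2]; exact hβ⟩
  · intro β hβ
    rw [Set.Finite.coe_toFinset, ← hcard β]
    congr 1
    ext α
    simp only [Set.mem_inter_iff, Set.mem_iUnion]
    constructor
    · rintro ⟨⟨β', hβ', hα⟩, hα'⟩
      have : β' = β := (hS β' hα).2.symm.trans hα'.2
      rwa [← this]
    · exact fun hα => ⟨⟨β, hβ, hα⟩, hS β hα⟩

/-- The polynomial formed by the terms of `f` with exponent in the finite set `A`. For
`A = A_lam(f)` this is `f̂^lam`. -/
def partialSum {n : ℕ} (f : MvPowerSeries (Fin n) ℂ) (A : Finset (Fin n →₀ ℕ)) :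
    MvPolynomial (Fin n) ℂ :=
  ∑ α ∈ A, MvPolynomial.monomial α (MvPowerSeries.coeff α f)

/-! ### Puiseux series -/

/-- The field of complex Puiseux series, as a subring of the Hahn series with rational
exponents: the series whose exponents have a common denominator. -/
def Puiseux : Subring (HahnSeries ℚ ℂ) where
  carrier := {p | ∃ N : ℕ, 0 < N ∧ ∀ q ∈ p.support, ∃ m : ℤ, q * N = m}
  mul_mem' := by
    rintro p p' ⟨N, hN, h⟩ ⟨N', hN', h'⟩
    refine ⟨N * N', Nat.mul_pos hN hN', fun q hq => ?_⟩
    obtain ⟨a, ha, b, hb, rfl⟩ := Set.mem_add.1 (HahnSeries.support_mul_subset hq)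
    obtain ⟨m, hm⟩ := h a ha
    obtain ⟨m', hm'⟩ := h' b hb
    refine ⟨m * N' + m' * N, ?_⟩
    push_cast
    rw [← hm, ← hm']
    ring
  add_mem' := by
    rintro p p' ⟨N, hN, h⟩ ⟨N', hN', h'⟩
    refine ⟨N * N', Nat.mul_pos hN hN', fun q hq => ?_⟩
    rcases HahnSeries.support_add_subset p p' hq with hq | hq
    · obtain ⟨m, hm⟩ := h q hq
      refine ⟨m * N', ?_⟩
      push_cast
      rw [← hm]
      ring
    · obtain ⟨m, hm⟩ := h' q hq
      refine ⟨m * N, ?_⟩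
      push_cast
      rw [← hm]
      ring
  neg_mem' := by
    rintro p ⟨N, hN, h⟩
    exact ⟨N, hN, fun q hq => h q (by rwa [HahnSeries.support_neg] at hq)⟩
  zero_mem' := ⟨1, one_pos, fun q hq => absurd rfl hq⟩
  one_mem' := ⟨1, one_pos, fun q hq => ⟨0, by
    have : q = 0 := by simpa using HahnSeries.support_single_subset hq
    simp [this]⟩⟩

/-- The constant Puiseux series. -/
def puiseuxC : ℂ →+* Puiseux :=
  (HahnSeries.C : ℂ →+* HahnSeries ℚ ℂ).codRestrict Puiseux fun c =>
    ⟨1, one_pos, fun q hq => ⟨0, by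
      have : q = 0 := by simpa using HahnSeries.support_single_subset hq
      simp [this]⟩⟩

/-- `V(g)`, the zeros of `g` in the torus over the Puiseux series. -/
def zeroSet {n : ℕ} (g : MvPolynomial (Fin n) ℂ) : Set (Fin n → Puiseux) :=
  {v | (∀ i, v i ≠ 0) ∧ MvPolynomial.eval₂ puiseuxC v g = 0}

/-- The coordinatewise order of a vector of (nonzero) Puiseux series. -/
def ord {n : ℕ} (v : Fin n → Puiseux) : Fin n → ℝ :=
  fun i => (((v i : HahnSeries ℚ ℂ).order : ℚ) : ℝ)

/-! ### The subsets of `U_loc` that are compared -/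

/-- The local weights `w` for which no `in_w(f)`, `f ∈ I`, is a monomial. -/
def noMonomialSet {n : ℕ} (I : Ideal (MvPowerSeries (Fin n) ℂ)) : Set (Fin n → ℝ) :=
  {w | ∃ hw : w ∈ ULoc n, ∀ f ∈ I, ¬ IsGrMonomial ⟨w, hw⟩ (initialForm ⟨w, hw⟩ f)}

/-- The intersection of the local tropical hypersurfaces of the elements of `I`. -/
def hypersurfaceSet {n : ℕ} (I : Ideal (MvPowerSeries (Fin n) ℂ)) : Set (Fin n → ℝ) :=
  ⋂ f ∈ I, tropHypersurface (trop f)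

/-- For an assignment `(lam, f) ↦ G lam f`, the union over the strata of the intersections of
the tropical hypersurfaces of the `G lam f`, `f ∈ I`, with the stratum. -/
def stratumTropSet {n : ℕ}
    (G : Finset (Fin n) → MvPowerSeries (Fin n) ℂ → MvPowerSeries (Fin n) ℂ)
    (I : Ideal (MvPowerSeries (Fin n) ℂ)) : Set (Fin n → ℝ) :=
  ⋃ lam : Finset (Fin n), (⋂ f ∈ I, tropHypersurface (trop (G lam f))) ∩ stratum lam

/-- For an assignment `(lam, f) ↦ G lam f` of polynomials, the union over the strata of the
intersections of the closures of the `ord V(G lam f)`, `f ∈ I`, with the stratum. For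
`G lam f = f̂^lam` this is the local tropical variety of `I`. -/
def stratumOrdSet {n : ℕ}
    (G : Finset (Fin n) → MvPowerSeries (Fin n) ℂ → MvPolynomial (Fin n) ℂ)
    (I : Ideal (MvPowerSeries (Fin n) ℂ)) : Set (Fin n → ℝ) :=
  ⋃ lam : Finset (Fin n), (⋂ f ∈ I, closure (ord '' zeroSet (G lam f))) ∩ stratum lam

/-- The polynomials `f̂^lam` determined by a choice of the sets `A_lam(f)`. -/
def hat {n : ℕ} (A : Finset (Fin n) → MvPowerSeries (Fin n) ℂ → Finset (Fin n →₀ ℕ))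
    (lam : Finset (Fin n)) (f : MvPowerSeries (Fin n) ℂ) : MvPolynomial (Fin n) ℂ :=
  partialSum f (A lam f)

/-- The `f̂^lam`, seen as power series. -/
def hatSeries {n : ℕ}
    (A : Finset (Fin n) → MvPowerSeries (Fin n) ℂ → Finset (Fin n →₀ ℕ))
    (lam : Finset (Fin n)) (f : MvPowerSeries (Fin n) ℂ) : MvPowerSeries (Fin n) ℂ :=
  (hat A lam f : MvPowerSeries (Fin n) ℂ)

/-- The local tropical variety `T_loc(I)`, for a choice of the sets `A_lam(f)`. -/
def localTropicalVariety {n : ℕ}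
    (A : Finset (Fin n) → MvPowerSeries (Fin n) ℂ → Finset (Fin n →₀ ℕ))
    (I : Ideal (MvPowerSeries (Fin n) ℂ)) : Set (Fin n → ℝ) :=
  stratumOrdSet (hat A) I

/-- The convention that the truncations attached to the stratum of the origin are all `0`. -/
def zeroAtOrigin {n : ℕ} {M : Type*} [Zero M]
    (G : Finset (Fin n) → MvPowerSeries (Fin n) ℂ → M)
    (lam : Finset (Fin n)) (f : MvPowerSeries (Fin n) ℂ) : M :=
  if lam = Finset.univ then 0 else G lam f

end LocalTropical

end

/-!
Everything is compared with one condition on a set `S` of exponents and a weight `w`: the minimum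
of `w · α` over `α ∈ S` is attained at least twice, or `S` is empty (`MinAttainedTwice S w`).

* The initial form of `f` at a local weight `w` is a monomial exactly when the minimum over
  `Supp(f)` is attained once (`isGrMonomial_initialForm_iff`), so the first two sets both consist
  of the `w` with `MinAttainedTwice (supp f) w` for all `f ∈ I`.
* On the stratum of `lam` the weight of an exponent depends only on its projection to the
  variables outside `lam`, and is strictly increasing in that projection. All minimizers over
  `Supp(f)` therefore lie over minimal exponents of `φ_lam(f)`, and two of them survive in every
  selection: both in one fibre if they share it, one in each fibre otherwise
  (`minAttainedTwice_supp_tilde_iff`, `minAttainedTwice_selection_iff`).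
* For a polynomial `g` over `ℂ`, the closure of `ord V(g)` is the set of all real `w` with
  `MinAttainedTwice g.support w` (`closure_ord_zeroSet`, Kapranov's theorem for constant
  coefficients). One inclusion holds because a sum of Puiseux series with a unique term of least
  order is not zero. For the other, a real weight is approximated by rational ones satisfying the
  same equalities, by moving a `ℚ`-basis of the `ℚ`-span of its coordinates. For a rational weight
  `q`, the substitution `x_i = t ^ q_i * y ^ m_i`, with `m` separating the exponents of `g`, leads
  to a polynomial in `y` over `ℂ⟦t ^ (1 / N)⟧`. Its reduction has at least two terms, hence a
  nonzero root, which has to be lifted to a Puiseux series.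
* This lift is the Newton–Puiseux theorem (`exists_puiseux_root`), proved by induction on the
  multiplicity of the root: Weierstrass preparation reduces to a distinguished polynomial, a
  Tschirnhausen transformation removes its second coefficient, and rescaling along the
  edge of the Newton polygon at its leading term gives a polynomial whose reduction has only roots
  of smaller multiplicity.

When all truncations at the origin are replaced by `0`, the condition at `w = 0` becomes void. It
was already satisfied if `I` contains no monomial, since at `w = 0` all exponents have the same
weight and every nonzero element of `I` has at least two terms.
-/

noncomputable section

namespace LocalTropical

/-! ### The Newton–Puiseux theorem -/

open Polynomial in
theorem coeff_taylor_pred {R : Type*} [CommRing R] (F : R[X]) {d : ℕ} (hd : 0 < d)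
    (hF : F.natDegree ≤ d) (r : R) :
    (taylor r F).coeff (d - 1) = F.coeff (d - 1) + d * r * F.coeff d := by
  obtain ⟨e, rfl⟩ : ∃ e, d = e + 1 := ⟨d - 1, by omega⟩
  have h : (hasseDeriv e F).natDegree < 2 :=
    lt_of_le_of_lt (natDegree_hasseDeriv_le F e) (by omega)
  rw [Nat.add_sub_cancel, taylor_coeff, eval_eq_sum_range' h]
  simp [Finset.sum_range_succ, hasseDeriv_coeff, add_comm 1 e]
  ring

theorem residue_eq_zero_iff (a : PowerSeries ℂ) :
    IsLocalRing.residue (PowerSeries ℂ) a = 0 ↔ PowerSeries.constantCoeff a = 0 := by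
  rw [IsLocalRing.residue_eq_zero_iff, PowerSeries.maximalIdeal_eq_span_X,
    Ideal.mem_span_singleton, PowerSeries.X_dvd_iff]

instance isAdicComplete_maximalIdeal_powerSeries :
    IsAdicComplete (IsLocalRing.maximalIdeal (PowerSeries ℂ)) (PowerSeries ℂ) := by
  rw [PowerSeries.maximalIdeal_eq_span_X]
  infer_instance

open Polynomial in
/-- Weierstrass preparation for a polynomial: the distinguished factor divides it in the polynomial
ring, and not only in the ring of power series. -/
theorem exists_distinguished_dvd (F : (PowerSeries ℂ)[X]) (d : ℕ)
    (hlt : ∀ i < d, PowerSeries.constantCoeff (F.coeff i) = 0)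
    (hd : PowerSeries.constantCoeff (F.coeff d) ≠ 0) :
    ∃ Q : (PowerSeries ℂ)[X], Q ∣ F ∧ Q.Monic ∧ Q.natDegree = d ∧
      ∀ i < d, PowerSeries.constantCoeff (Q.coeff i) = 0 := by
  have hne : (F : PowerSeries (PowerSeries ℂ)).map (IsLocalRing.residue _) ≠ 0 := by
    intro h
    apply hd
    rw [← residue_eq_zero_iff]
    simpa using congrArg (PowerSeries.coeff d) h
  obtain ⟨Q, h, H⟩ := PowerSeries.exists_isWeierstrassFactorization hne
  have hord : ((F : PowerSeries (PowerSeries ℂ)).map (IsLocalRing.residue _)).order = d := by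
    rw [PowerSeries.order_eq_nat]
    refine ⟨?_, fun i hi => ?_⟩
    · simpa only [PowerSeries.coeff_map, Polynomial.coeff_coe, ne_eq, residue_eq_zero_iff] using hd
    · simpa only [PowerSeries.coeff_map, Polynomial.coeff_coe, residue_eq_zero_iff] using hlt i hi
  have hdeg : Q.natDegree = d := by
    rw [H.natDegree_eq_toNat_order_map, hord, ENat.toNat_natCast]
  have hmonic := H.isDistinguishedAt.monic
  have hQlt : ∀ i < d, PowerSeries.constantCoeff (Q.coeff i) = 0 := fun i hi => by
    have := H.isDistinguishedAt.mem (n := i) (by omega)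
    rwa [← residue_eq_zero_iff, IsLocalRing.residue_eq_zero_iff]
  refine ⟨Q, ?_, hmonic, hdeg, hQlt⟩
  have hQord : ((Q : PowerSeries (PowerSeries ℂ)).map (IsLocalRing.residue _)).order = d := by
    rw [PowerSeries.order_eq_nat]
    refine ⟨?_, fun i hi => ?_⟩
    · have : Q.coeff d = 1 := by rw [← hdeg]; exact hmonic
      simp [this]
    · simpa only [PowerSeries.coeff_map, Polynomial.coeff_coe, residue_eq_zero_iff] using hQlt i hi
  have hQne : (Q : PowerSeries (PowerSeries ℂ)).map (IsLocalRing.residue _) ≠ 0 := by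
    rw [← PowerSeries.order_finite_iff_ne_zero, hQord]
    exact ENat.natCast_lt_top d
  have hQtoNat : (PowerSeries.order ((Q : PowerSeries (PowerSeries ℂ)).map
      (Ideal.Quotient.mk (IsLocalRing.maximalIdeal (PowerSeries ℂ))))).toNat = d :=
     (congrArg ENat.toNat hQord).trans (ENat.toNat_natCast d)
  -- The remainder of the polynomial division of `F` by `Q` is that of the Weierstrass division.
  have D1 : (F : PowerSeries (PowerSeries ℂ)).IsWeierstrassDivision Q h 0 :=
    ⟨by rw [degree_zero]; exact WithBot.bot_lt_coe _, by simpa using H.eq_mul⟩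
  have D2 : (F : PowerSeries (PowerSeries ℂ)).IsWeierstrassDivision Q
      (F /ₘ Q : (PowerSeries ℂ)[X]) (F %ₘ Q) := by
    refine ⟨?_, ?_⟩
    · rw [hQtoNat, ← hdeg, ← degree_eq_natDegree hmonic.ne_zero]
      exact degree_modByMonic_lt F hmonic
    · conv_lhs => rw [← modByMonic_add_div F Q]
      push_cast
      ring
  have := (D1.elim hQne D2).2
  rw [← modByMonic_eq_zero_iff_dvd hmonic, ← this]

/-- The ramification `X ↦ X ^ M` of `ℂ⟦X⟧`, as a ring homomorphism. -/
abbrev ramify (M : ℕ) (hM : M ≠ 0) : PowerSeries ℂ →+* PowerSeries ℂ :=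
  (PowerSeries.expand M hM).toRingHom

open Polynomial in
/-- A monic polynomial with vanishing second coefficient that is not a power of the variable is not
a power of a linear polynomial either, so its roots have multiplicity less than its degree. The
multiplicity `d'` of the root `r` is the degree of the first nonzero coefficient of
the Taylor expansion at `r`. -/
theorem exists_translate_lower_multiplicity (g : ℂ[X]) {d i₀ : ℕ} (hg : g.Monic)
    (hd : g.natDegree = d) (hi₀ : i₀ < d) (h1 : g.coeff (d - 1) = 0) (h2 : g.coeff i₀ ≠ 0) :
    ∃ (r : ℂ) (d' : ℕ), 0 < d' ∧ d' < d ∧ (∀ i < d', (taylor r g).coeff i = 0) ∧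
      (taylor r g).coeff d' ≠ 0 := by
  obtain ⟨r, hr⟩ := IsAlgClosed.exists_root g (by
    rw [degree_eq_natDegree hg.ne_zero, hd]
    exact_mod_cast (by omega : d ≠ 0))
  have hT : taylor r g ≠ 0 := by
    rw [Ne, taylor_eq_zero]
    exact hg.ne_zero
  refine ⟨r, (taylor r g).natTrailingDegree, ?_, ?_, fun i hi =>
    coeff_eq_zero_of_lt_natTrailingDegree hi, ?_⟩
  · rw [Nat.pos_iff_ne_zero]
    intro h
    rw [natTrailingDegree_eq_zero] at h
    rcases h with h | h
    · exact hT h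
    · exact h (by rw [taylor_coeff_zero]; exact hr)
  · by_contra hlt
    push Not at hlt
    have hc := coeff_taylor_pred g (by omega : 0 < d) hd.le r
    have hlc : g.coeff d = 1 := by rw [← hd]; exact hg
    rw [coeff_eq_zero_of_lt_natTrailingDegree (by omega), h1, hlc] at hc
    -- The coefficient of degree `d - 1` of the expansion is `d * r`, so `r = 0`.
    have hr0 : r = 0 := by
      have : (d : ℂ) ≠ 0 := by exact_mod_cast (by omega : d ≠ 0)
      simpa [this] using hc.symm
    apply h2
    have := coeff_eq_zero_of_lt_natTrailingDegree (p := taylor r g) (n := i₀) (by omega)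
    rwa [hr0, taylor_zero] at this
  · exact trailingCoeff_nonzero_iff_nonzero.2 hT

open Polynomial in
/-- The slope `a / (d - i₀)` of the edge of the Newton polygon that ends at `(d, 0)` is the minimum
of `ord (F_i) / (d - i)`: after the ramification of index `d - i₀`, the coefficient of degree `i`
is divisible by `X ^ (a * (d - i))`, and by no higher power for `i = i₀`. -/
theorem exists_newton_slope (F : (PowerSeries ℂ)[X]) {d : ℕ}
    (hlt : ∀ i < d, PowerSeries.constantCoeff (F.coeff i) = 0)
    (hne : ∃ i < d, F.coeff i ≠ 0) :
    ∃ i₀ < d, ∃ (a : ℕ), 0 < a ∧ ∃ hb : d - i₀ ≠ 0,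
      (∀ i < d, PowerSeries.X ^ (a * (d - i)) ∣ ramify (d - i₀) hb (F.coeff i)) ∧
      ∃ g, ramify (d - i₀) hb (F.coeff i₀) = PowerSeries.X ^ (a * (d - i₀)) * g ∧
        PowerSeries.constantCoeff g ≠ 0 := by
  classical
  obtain ⟨i₀, hi₀, hmin⟩ := Finset.exists_min_image
    ((Finset.range d).filter fun i => F.coeff i ≠ 0)
    (fun i => ((F.coeff i).order.toNat : ℚ) / ((d - i : ℕ) : ℚ)) (by
      obtain ⟨i, hi, h⟩ := hne
      exact ⟨i, by simp [hi, h]⟩)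
  simp only [Finset.mem_filter, Finset.mem_range] at hi₀ hmin
  have hfac : ∀ i, F.coeff i ≠ 0 → ∃ u, F.coeff i = PowerSeries.X ^ (F.coeff i).order.toNat * u ∧
      PowerSeries.constantCoeff u ≠ 0 := by
    intro i hi
    obtain ⟨u, hu⟩ := PowerSeries.X_pow_order_dvd (φ := F.coeff i)
    refine ⟨u, hu, ?_⟩
    have := congrArg (PowerSeries.coeff (F.coeff i).order.toNat) hu
    rw [PowerSeries.coeff_X_pow_mul', if_pos le_rfl, Nat.sub_self] at this
    rw [← PowerSeries.coeff_zero_eq_constantCoeff_apply, ← this]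
    exact PowerSeries.coeff_order hi
  have hb : d - i₀ ≠ 0 := by omega
  refine ⟨i₀, hi₀.1, (F.coeff i₀).order.toNat, ?_, hb, ?_, ?_⟩
  · rw [Nat.pos_iff_ne_zero]
    intro h0
    obtain ⟨u, hu, hu0⟩ := hfac i₀ hi₀.2
    rw [h0, pow_zero, one_mul] at hu
    exact hu0 (by rw [← hu]; exact hlt i₀ hi₀.1)
  · intro i hi
    by_cases h : F.coeff i = 0
    · rw [h, map_zero]
      exact dvd_zero _
    · obtain ⟨u, hu, -⟩ := hfac i h
      have hm := hmin i ⟨hi, h⟩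
      have p1 : (0 : ℚ) < ((d - i₀ : ℕ) : ℚ) := by exact_mod_cast Nat.pos_of_ne_zero hb
      have p2 : (0 : ℚ) < ((d - i : ℕ) : ℚ) := by exact_mod_cast (by omega : 0 < d - i)
      rw [div_le_div_iff₀ p1 p2] at hm
      have hm' : (F.coeff i₀).order.toNat * (d - i) ≤ (F.coeff i).order.toNat * (d - i₀) := by
        exact_mod_cast hm
      rw [hu, map_mul, map_pow]
      refine Dvd.dvd.mul_right ?_ _
      have : ramify (d - i₀) hb PowerSeries.X = PowerSeries.X ^ (d - i₀) :=
        PowerSeries.expand_X _ _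
      rw [this, ← pow_mul]
      exact pow_dvd_pow _ (by rw [mul_comm (d - i₀)]; exact hm')
  · obtain ⟨u, hu, hu0⟩ := hfac i₀ hi₀.2
    refine ⟨ramify (d - i₀) hb u, ?_, ?_⟩
    · have : ramify (d - i₀) hb PowerSeries.X = PowerSeries.X ^ (d - i₀) :=
        PowerSeries.expand_X _ _
      conv_lhs => rw [hu, map_mul, map_pow, this, ← pow_mul]
      rw [mul_comm (d - i₀)]
    · have : PowerSeries.constantCoeff (ramify (d - i₀) hb u) = PowerSeries.constantCoeff u :=
        PowerSeries.constantCoeff_expand _ _ u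
      rwa [this]

theorem ramify_ramify (M M' : ℕ) (hM : M ≠ 0) (hM' : M' ≠ 0) (f : PowerSeries ℂ) :
    ramify (M * M') (mul_ne_zero hM hM') f = ramify M hM (ramify M' hM' f) :=
  PowerSeries.expand_mul _ _ _ _ f

theorem ramify_X (M : ℕ) (hM : M ≠ 0) : ramify M hM PowerSeries.X = PowerSeries.X ^ M :=
  PowerSeries.expand_X _ _

theorem ramify_C (M : ℕ) (hM : M ≠ 0) (c : ℂ) :
    ramify M hM (PowerSeries.C c) = PowerSeries.C c :=
  PowerSeries.expand_C _ _ _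

open Polynomial in
theorem eval₂_taylor {R S : Type*} [CommRing R] [CommRing S] (f : R →+* S) (F : R[X]) (r : R)
    (z : S) : (taylor r F).eval₂ f z = F.eval₂ f (z + f r) := by
  rw [taylor_apply, eval₂_comp]
  simp

open Polynomial in
/-- **Newton–Puiseux theorem**: if the reduction of `F` modulo `X` has the root `0` with
multiplicity `d > 0`, then `F` has a root with constant term `0` after a ramification of its
coefficients. -/
theorem exists_puiseux_root (d : ℕ) : ∀ F : (PowerSeries ℂ)[X], 0 < d →
    (∀ i < d, PowerSeries.constantCoeff (F.coeff i) = 0) →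
    PowerSeries.constantCoeff (F.coeff d) ≠ 0 →
    ∃ (M : ℕ) (hM : M ≠ 0) (z : PowerSeries ℂ), PowerSeries.constantCoeff z = 0 ∧
      F.eval₂ (ramify M hM) z = 0 := by
  induction d using Nat.strong_induction_on with
  | _ d ih =>
  intro F hd hlt hne
  obtain ⟨Q, hQF, hQm, hQd, hQlt⟩ := exists_distinguished_dvd F d hlt hne
  suffices h : ∃ (M : ℕ) (hM : M ≠ 0) (z : PowerSeries ℂ), PowerSeries.constantCoeff z = 0 ∧
      Q.eval₂ (ramify M hM) z = 0 by
    obtain ⟨M, hM, z, hz, h0⟩ := h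
    obtain ⟨H, rfl⟩ := hQF
    exact ⟨M, hM, z, hz, by rw [eval₂_mul, h0, zero_mul]⟩
  have hQc : Q.coeff d = 1 := by rw [← hQd]; exact hQm
  -- Tschirnhausen transformation: the coefficient of degree `d - 1` is made zero.
  set s : PowerSeries ℂ := PowerSeries.C (-(d : ℂ)⁻¹) * Q.coeff (d - 1) with hs
  have hs0 : PowerSeries.constantCoeff s = 0 := by
    rw [hs, map_mul, hQlt (d - 1) (by omega), mul_zero]
  set F₁ := taylor s Q with hF₁
  have hF₁d : F₁.natDegree = d := by rw [hF₁, natDegree_taylor, hQd]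
  have hF₁c : F₁.coeff d = 1 := by
    rw [hF₁, ← hQd, coeff_taylor_natDegree]
    exact hQm
  have hF₁pred : F₁.coeff (d - 1) = 0 := by
    rw [hF₁, coeff_taylor_pred Q hd hQd.le, hQc, hs]
    have hd0 : (d : ℂ) ≠ 0 := by exact_mod_cast hd.ne'
    have : (d : PowerSeries ℂ) * PowerSeries.C (-(d : ℂ)⁻¹) = -1 := by
      have e : (d : PowerSeries ℂ) = PowerSeries.C (d : ℂ) := by simp
      rw [e, ← map_mul, mul_neg, mul_inv_cancel₀ hd0, map_neg, map_one]
    linear_combination Q.coeff (d - 1) * this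
  have hF₁lt : ∀ i < d, PowerSeries.constantCoeff (F₁.coeff i) = 0 := by
    have hQmap : Q.map PowerSeries.constantCoeff = X ^ d := by
      ext i
      rw [coeff_map, coeff_X_pow]
      rcases lt_trichotomy i d with h | rfl | h
      · rw [hQlt i h, if_neg (by omega)]
      · rw [hQc, map_one, if_pos rfl]
      · rw [coeff_eq_zero_of_natDegree_lt (by omega), map_zero, if_neg (by omega)]
    intro i hi
    have h : F₁.map PowerSeries.constantCoeff = X ^ d := by
      rw [hF₁, taylor_apply, map_comp, hQmap]
      simp [hs0]
    rw [← coeff_map, h, coeff_X_pow, if_neg (by omega)]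
  suffices h : ∃ (M : ℕ) (hM : M ≠ 0) (z : PowerSeries ℂ), PowerSeries.constantCoeff z = 0 ∧
      F₁.eval₂ (ramify M hM) z = 0 by
    obtain ⟨M, hM, z, hz, h0⟩ := h
    refine ⟨M, hM, z + ramify M hM s, ?_, by rw [← eval₂_taylor]; exact h0⟩
    have : PowerSeries.constantCoeff (ramify M hM s) = PowerSeries.constantCoeff s :=
      PowerSeries.constantCoeff_expand _ _ s
    rw [map_add, hz, this, hs0, add_zero]
  by_cases hall : ∀ i < d, F₁.coeff i = 0
  · refine ⟨1, one_ne_zero, 0, map_zero _, ?_⟩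
    rw [eval₂_at_zero, hall 0 hd, map_zero]
  push Not at hall
  obtain ⟨i₀, hi₀, a, ha, hb, hdvd, g₀, hg₀, hg₀c⟩ := exists_newton_slope F₁ hF₁lt hall
  -- The substitution `Y = X ^ a * Z` turns `F₁`, up to a power of `X`, into `∑ g i * Z ^ i`.
  have hex : ∀ i, ∃ g, i ≤ d →
      ramify (d - i₀) hb (F₁.coeff i) = PowerSeries.X ^ (a * (d - i)) * g := by
    intro i
    by_cases hi : i < d
    · obtain ⟨g, hg⟩ := hdvd i hi
      exact ⟨g, fun _ => hg⟩
    · refine ⟨1, fun hi' => ?_⟩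
      obtain rfl : i = d := by omega
      rw [hF₁c]
      simp
  choose g hg using hex
  have hXne : ∀ k : ℕ, (PowerSeries.X : PowerSeries ℂ) ^ k ≠ 0 :=
    fun k => pow_ne_zero _ PowerSeries.X_ne_zero
  have hgd : g d = 1 := by
    have := hg d le_rfl
    rw [hF₁c] at this
    simpa using this.symm
  have hgpred : g (d - 1) = 0 := by
    have := hg (d - 1) (by omega)
    rw [hF₁pred, map_zero] at this
    exact (mul_eq_zero.1 this.symm).resolve_left (hXne _)
  have hgi₀ : PowerSeries.constantCoeff (g i₀) ≠ 0 := by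
    have := hg i₀ hi₀.le
    rw [hg₀] at this
    rw [← mul_left_cancel₀ (hXne _) this]
    exact hg₀c
  set G : (PowerSeries ℂ)[X] := ∑ i ∈ Finset.range (d + 1), monomial i (g i) with hG
  have hGc : ∀ i, G.coeff i = if i ≤ d then g i else 0 := by
    intro i
    rw [hG, finsetSum_coeff]
    simp [coeff_monomial]
  set Gb := G.map PowerSeries.constantCoeff with hGb
  have hGbc : ∀ i ≤ d, Gb.coeff i = PowerSeries.constantCoeff (g i) := by
    intro i hi
    rw [hGb, coeff_map, hGc, if_pos hi]
  have hGbd' : Gb.natDegree ≤ d := by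
    rw [natDegree_le_iff_coeff_eq_zero]
    intro i hi
    rw [hGb, coeff_map, hGc, if_neg (by omega), map_zero]
  have hGbtop : Gb.coeff d = 1 := by rw [hGbc d le_rfl, hgd, map_one]
  have hGbd : Gb.natDegree = d :=
    le_antisymm hGbd' (le_natDegree_of_ne_zero (by rw [hGbtop]; exact one_ne_zero))
  have hGbm : Gb.Monic := by rw [Monic, leadingCoeff, hGbd, hGbtop]
  obtain ⟨r, d', hd'0, hd'd, hrlt, hrne⟩ := exists_translate_lower_multiplicity Gb hGbm hGbd hi₀
    (by rw [hGbc _ (by omega), hgpred, map_zero]) (by rw [hGbc _ hi₀.le]; exact hgi₀)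
  have htay : (taylor (PowerSeries.C r) G).map PowerSeries.constantCoeff = taylor r Gb := by
    rw [taylor_apply, map_comp, taylor_apply]
    simp [hGb]
  obtain ⟨M, hM, z, hz, h0⟩ := ih d' hd'd (taylor (PowerSeries.C r) G) hd'0
    (fun i hi => by rw [← coeff_map, htay]; exact hrlt i hi)
    (by rw [← coeff_map, htay]; exact hrne)
  rw [eval₂_taylor, ramify_C] at h0
  refine ⟨M * (d - i₀), mul_ne_zero hM hb, PowerSeries.X ^ (M * a) * (z + PowerSeries.C r), ?_, ?_⟩
  · rw [map_mul, map_pow, PowerSeries.constantCoeff_X, zero_pow (by positivity), zero_mul]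
  · have hsum : F₁.eval₂ (ramify (M * (d - i₀)) (mul_ne_zero hM hb))
        (PowerSeries.X ^ (M * a) * (z + PowerSeries.C r)) =
        PowerSeries.X ^ (M * a * d) * G.eval₂ (ramify M hM) (z + PowerSeries.C r) := by
      rw [eval₂_eq_sum_range, hF₁d, hG, eval₂_finsetSum, Finset.mul_sum]
      refine Finset.sum_congr rfl fun i hi => ?_
      have hid : i ≤ d := by simpa [Nat.lt_succ_iff] using hi
      rw [ramify_ramify M (d - i₀) hM hb, hg i hid, map_mul, map_pow, ramify_X, eval₂_monomial,
        mul_pow, ← pow_mul, ← pow_mul]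
      have : M * a * d = M * (a * (d - i)) + M * a * i := by
        obtain ⟨k, rfl⟩ := Nat.exists_eq_add_of_le hid
        rw [Nat.add_sub_cancel_left]
        ring
      rw [this, pow_add]
      ring
    rw [hsum, h0, mul_zero]

/-! ### Weights at which a minimum is attained twice -/

/-- The minimum of the `w`-weights of the exponents in `S` is attained at least twice. As for
tropical hypersurfaces, this holds by convention for the empty set. -/
def MinAttainedTwice {n : ℕ} (S : Set (Fin n →₀ ℕ)) (w : Fin n → ℝ) : Prop :=
  S = ∅ ∨ ∃ α ∈ S, ∃ β ∈ S, α ≠ β ∧ dotExp w α = dotExp w β ∧ ∀ γ ∈ S, dotExp w α ≤ dotExp w γ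

theorem continuous_dotExp {n : ℕ} (α : Fin n →₀ ℕ) :
    Continuous fun w : Fin n → ℝ => dotExp w α := by
  unfold dotExp
  fun_prop

theorem isClosed_minAttainedTwice {n : ℕ} {S : Set (Fin n →₀ ℕ)} (hS : S.Finite) :
    IsClosed {w | MinAttainedTwice S w} := by
  have h : {w | MinAttainedTwice S w} = {_w : Fin n → ℝ | S = ∅} ∪
      ⋃ α ∈ S, ⋃ β ∈ S, {w | α ≠ β} ∩ ({w | dotExp w α = dotExp w β} ∩
        ⋂ γ ∈ S, {w | dotExp w α ≤ dotExp w γ}) := by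
    ext w
    simp only [MinAttainedTwice, Set.mem_ofPred_eq, Set.mem_union, Set.mem_iUnion,
      Set.mem_inter_iff, Set.mem_iInter, exists_prop]
  rw [h]
  refine isClosed_const.union (hS.isClosed_biUnion fun α _ => hS.isClosed_biUnion fun β _ =>
    isClosed_const.inter ((isClosed_eq (continuous_dotExp α) (continuous_dotExp β)).inter
      (isClosed_biInter fun γ _ => isClosed_le (continuous_dotExp α) (continuous_dotExp γ))))

/-- Rational weights are dense among the weights at which the minimum over `S` is attained twice. -/
theorem mem_closure_rational_minAttainedTwice {n : ℕ} {S : Set (Fin n →₀ ℕ)} (hS : S.Finite)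
    {w : Fin n → ℝ} (hw : MinAttainedTwice S w) :
    w ∈ closure {w' | MinAttainedTwice S w' ∧ ∃ q : Fin n → ℚ, w' = fun i => (q i : ℝ)} := by
  classical
  have hfin : FiniteDimensional ℚ (Submodule.span ℚ (Set.range w)) :=
    FiniteDimensional.span_of_finite ℚ (Set.finite_range w)
  set b := Module.finBasis ℚ (Submodule.span ℚ (Set.range w)) with hb
  set k := Module.finrank ℚ (Submodule.span ℚ (Set.range w))
  set W : Fin n → Submodule.span ℚ (Set.range w) :=
    fun i => ⟨w i, Submodule.subset_span ⟨i, rfl⟩⟩ with hW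
  set L : (Fin k → ℝ) → (Fin n → ℝ) := fun r i => ∑ j, (b.repr (W i) j : ℝ) * r j with hL
  -- `L` moves the basis `b` to arbitrary reals; it preserves the rational relations between the
  -- coordinates of `w`.
  have hLcont : Continuous L := by
    rw [hL]
    fun_prop
  have hLb : L (fun j => (b j : ℝ)) = w := by
    funext i
    have h := congrArg (Submodule.subtype _) (b.sum_repr (W i))
    rw [map_sum] at h
    simpa [hL, hW, Rat.smul_def] using h
  have hLeq : ∀ α β : Fin n →₀ ℕ, dotExp w α = dotExp w β → ∀ r,
      dotExp (L r) α = dotExp (L r) β := by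
    intro α β h r
    have h1 : ∑ i, (α i : ℚ) • W i = ∑ i, (β i : ℚ) • W i := by
      apply Subtype.ext
      simpa [hW, Rat.smul_def, dotExp, mul_comm] using h
    have h2 : ∀ j, ∑ i, (α i : ℝ) * (b.repr (W i) j : ℝ) =
        ∑ i, (β i : ℝ) * (b.repr (W i) j : ℝ) := by
      intro j
      have := congrArg (fun x => b.repr x j) h1
      simp only [map_sum, map_smul, Finsupp.coe_finsetSum, Finset.sum_apply, Finsupp.smul_apply,
        smul_eq_mul] at this
      exact_mod_cast this
    have h3 : ∀ α : Fin n →₀ ℕ, dotExp (L r) α =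
        ∑ j, (∑ i, (α i : ℝ) * (b.repr (W i) j : ℝ)) * r j := by
      intro α
      simp only [dotExp, hL, Finset.sum_mul]
      rw [Finset.sum_comm]
      refine Finset.sum_congr rfl fun j _ => Finset.sum_congr rfl fun i _ => by ring
    rw [h3, h3]
    exact Finset.sum_congr rfl fun j _ => by rw [h2 j]
  have hdense : DenseRange fun (r : Fin k → ℚ) (j : Fin k) => (r j : ℝ) :=
    DenseRange.piMap fun _ => Rat.denseRange_cast
  have hrat : ∀ r : Fin k → ℚ, ∃ q : Fin n → ℚ, L (fun j => (r j : ℝ)) = fun i => (q i : ℝ) :=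
    fun r => ⟨fun i => ∑ j, b.repr (W i) j * r j, by
      funext i
      simp [hL]⟩
  rw [mem_closure_iff]
  intro O hO hwO
  rcases hw with rfl | ⟨α, hα, β, hβ, hne, heq, hmin⟩
  · obtain ⟨r, hr⟩ := hdense.exists_mem_open (hO.preimage hLcont)
      ⟨fun j => (b j : ℝ), by rw [Set.mem_preimage, hLb]; exact hwO⟩
    exact ⟨_, hr, Or.inl rfl, hrat r⟩
  · set T := {γ ∈ S | dotExp w α < dotExp w γ}
    have hT : T.Finite := hS.subset fun γ h => h.1
    have hU : IsOpen (⋂ γ ∈ T, {r | dotExp (L r) α < dotExp (L r) γ}) :=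
      hT.isOpen_biInter fun γ _ => isOpen_lt ((continuous_dotExp α).comp hLcont)
        ((continuous_dotExp γ).comp hLcont)
    obtain ⟨r, hrO, hrU⟩ := hdense.exists_mem_open ((hO.preimage hLcont).inter hU)
      ⟨fun j => (b j : ℝ), by rw [Set.mem_preimage, hLb]; exact hwO, by
        simp only [Set.mem_iInter]
        intro γ hγ
        simpa only [Set.mem_ofPred_eq, hLb] using hγ.2⟩
    refine ⟨_, hrO, Or.inr ⟨α, hα, β, hβ, hne, hLeq _ _ heq _, fun γ hγ => ?_⟩, hrat r⟩
    rcases (hmin γ hγ).eq_or_lt with h | h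
    · exact (hLeq _ _ h _).le
    · simp only [Set.mem_iInter] at hrU
      exact (hrU γ ⟨hγ, h⟩).le

/-! ### Orders of zeros over the Puiseux series -/

theorem order_prod_pow {n : ℕ} (v : Fin n → HahnSeries ℚ ℂ) (hv : ∀ i, v i ≠ 0)
    (α : Fin n →₀ ℕ) : (∏ i, v i ^ α i).order = ∑ i, (α i : ℚ) * (v i).order := by
  classical
  have h : ∀ s : Finset (Fin n), (∏ i ∈ s, v i ^ α i).order =
      ∑ i ∈ s, (α i : ℚ) * (v i).order := by
    intro s
    induction s using Finset.induction_on with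
    | empty => simp
    | insert a s ha ih =>
      rw [Finset.prod_insert ha, Finset.sum_insert ha, HahnSeries.order_mul
        (pow_ne_zero _ (hv a)) (Finset.prod_ne_zero_iff.2 fun i _ => pow_ne_zero _ (hv i)), ih,
        HahnSeries.order_pow, nsmul_eq_mul]
  exact h Finset.univ

/-- The terms of `g` at a zero sum up to `0`, so a unique term of least order is impossible. -/
theorem minAttainedTwice_ord {n : ℕ} (g : MvPolynomial (Fin n) ℂ) {v : Fin n → Puiseux}
    (hv : v ∈ zeroSet g) : MinAttainedTwice (g.support : Set (Fin n →₀ ℕ)) (ord v) := by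
  classical
  rcases g.support.eq_empty_or_nonempty with h0 | hne
  · exact Or.inl (by rw [h0]; simp)
  right
  obtain ⟨α, hα, hmin⟩ := Finset.exists_min_image g.support (dotExp (ord v)) hne
  by_contra hcon
  have hlt : ∀ β ∈ g.support, β ≠ α → dotExp (ord v) α < dotExp (ord v) β := by
    intro β hβ hβα
    refine (hmin β hβ).lt_of_ne fun h => hcon ⟨α, hα, β, hβ, hβα.symm, h, hmin⟩
  set V : Fin n → HahnSeries ℚ ℂ := fun i => (v i : HahnSeries ℚ ℂ) with hV
  have hV0 : ∀ i, V i ≠ 0 := fun i h => hv.1 i (Subtype.ext h)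
  set τ : (Fin n →₀ ℕ) → HahnSeries ℚ ℂ :=
    fun β => HahnSeries.C (g.coeff β) * ∏ i, V i ^ β i with hτ
  have hsum : ∑ β ∈ g.support, τ β = 0 := by
    have h := congrArg (Subring.subtype Puiseux) hv.2
    rw [MvPolynomial.eval₂_eq', map_sum, map_zero] at h
    rw [← h]
    refine Finset.sum_congr rfl fun β _ => ?_
    rw [map_mul, map_prod]
    simp only [map_pow]
    rfl
  have hP0 : ∀ β : Fin n →₀ ℕ, ∏ i, V i ^ β i ≠ 0 := fun β =>
    Finset.prod_ne_zero_iff.2 fun i _ => pow_ne_zero _ (hV0 i)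
  have hdot : ∀ β, dotExp (ord v) β = (((∏ i, V i ^ β i).order : ℚ) : ℝ) := by
    intro β
    rw [order_prod_pow V hV0, dotExp]
    push_cast
    exact Finset.sum_congr rfl fun i _ => mul_comm _ _
  have hcoeff : ∀ β x, (τ β).coeff x = g.coeff β * (∏ i, V i ^ β i).coeff x := by
    intro β x
    simp only [hτ]
    rw [HahnSeries.C_mul_eq_smul, HahnSeries.coeff_smul, smul_eq_mul]
  have hx := congrArg (fun p => HahnSeries.coeff p (∏ i, V i ^ α i).order) hsum
  simp only [HahnSeries.coeff_sum, HahnSeries.coeff_zero] at hx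
  rw [Finset.sum_eq_single_of_mem α hα, hcoeff] at hx
  · rcases mul_eq_zero.1 hx with h | h
    · exact MvPolynomial.mem_support_iff.1 hα h
    · exact HahnSeries.coeff_order_eq_zero.not.2 (hP0 α) h
  · intro β hβ hβα
    rw [hcoeff, HahnSeries.coeff_eq_zero_of_lt_order, mul_zero]
    have := hlt β hβ hβα
    rw [hdot, hdot] at this
    exact_mod_cast this

/-! ### Zeros of given rational order -/

theorem exists_separating_weight {n : ℕ} (S : Finset (Fin n →₀ ℕ)) :
    ∃ m : Fin n → ℕ, Set.InjOn (fun α : Fin n →₀ ℕ => ∑ i, m i * α i) (S : Set (Fin n →₀ ℕ)) := by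
  classical
  obtain ⟨B, hB⟩ : ∃ B : ℕ, ∀ α ∈ S, ∀ i, α i < B := by
    refine ⟨S.sup (fun α => Finset.univ.sup α) + 1, fun α hα i => Nat.lt_succ_of_le ?_⟩
    exact (Finset.le_sup (f := (α : Fin n → ℕ)) (Finset.mem_univ i)).trans
      (Finset.le_sup (f := fun α : Fin n →₀ ℕ => Finset.univ.sup α) hα)
  -- The sums are expansions in base `B`, with the entries of the exponents as digits.
  refine ⟨fun i => B ^ (i : ℕ), fun α hα β hβ h => ?_⟩
  have key := finFunctionFinEquiv.injective (a₁ := fun i => (⟨α i, hB α hα i⟩ : Fin B))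
    (a₂ := fun i => (⟨β i, hB β hβ i⟩ : Fin B)) (by
      apply Fin.ext
      rw [finFunctionFinEquiv_apply_val, finFunctionFinEquiv_apply_val]
      simpa [mul_comm] using h)
  ext i
  exact congrArg Fin.val (congrFun key i)

open Polynomial in
theorem exists_nonzero_root (p : ℂ[X]) {i j : ℕ} (hij : i ≠ j) (hi : p.coeff i ≠ 0)
    (hj : p.coeff j ≠ 0) : ∃ r, r ≠ 0 ∧ p.eval r = 0 := by
  have hp : p ≠ 0 := by
    rintro rfl
    exact hi (coeff_zero _)
  obtain ⟨h, hph, hnd⟩ := exists_eq_pow_rootMultiplicity_mul_and_not_dvd p hp 0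
  rw [map_zero, sub_zero] at hph hnd
  by_cases hdeg : h.degree = 0
  · exfalso
    rw [eq_C_of_degree_eq_zero hdeg] at hph
    have hc : ∀ l, p.coeff l ≠ 0 → l = rootMultiplicity 0 p := by
      intro l hl
      by_contra hne
      apply hl
      rw [hph, coeff_mul_C, coeff_X_pow, if_neg hne, zero_mul]
    exact hij ((hc i hi).trans (hc j hj).symm)
  · obtain ⟨r, hr⟩ := IsAlgClosed.exists_root h hdeg
    refine ⟨r, ?_, ?_⟩
    · rintro rfl
      exact hnd (X_dvd_iff.2 (by rw [coeff_zero_eq_eval_zero]; exact hr))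
    · rw [hph, eval_mul, hr.eq_zero, mul_zero]

/-- The Puiseux series `t ^ q`. -/
def puiseuxT (q : ℚ) : Puiseux :=
  ⟨HahnSeries.single q 1, q.den, q.den_pos, fun q' hq' => ⟨q.num, by
    have : q' = q := by simpa using HahnSeries.support_single_subset hq'
    rw [this, Rat.mul_den_eq_num]⟩⟩

theorem puiseuxT_add (a b : ℚ) : puiseuxT (a + b) = puiseuxT a * puiseuxT b := by
  apply Subtype.ext
  simp [puiseuxT, HahnSeries.single_mul_single]

theorem puiseuxT_zero : puiseuxT 0 = 1 := rfl

theorem puiseuxT_pow (a : ℚ) (k : ℕ) : puiseuxT a ^ k = puiseuxT (k * a) := by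
  induction k with
  | zero => simp [puiseuxT_zero]
  | succ k ih =>
    rw [pow_succ, ih, ← puiseuxT_add]
    congr 1
    push_cast
    ring

theorem puiseuxT_sum {ι : Type*} (s : Finset ι) (f : ι → ℚ) :
    puiseuxT (∑ i ∈ s, f i) = ∏ i ∈ s, puiseuxT (f i) := by
  classical
  induction s using Finset.induction_on with
  | empty => simp [puiseuxT_zero]
  | insert a s ha ih => rw [Finset.sum_insert ha, Finset.prod_insert ha, puiseuxT_add, ih]

/-- The homomorphism `k ↦ k / D` from `ℕ` to `ℚ`. -/
def divNatHom (D : ℕ) : ℕ →+ ℚ where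
  toFun k := k / D
  map_zero' := by simp
  map_add' a b := by push_cast; ring

/-- The embedding `X ↦ t ^ (1 / D)` of the power series into the Hahn series. -/
def hahnOfPowerSeries (D : ℕ) (hD : D ≠ 0) : PowerSeries ℂ →+* HahnSeries ℚ ℂ :=
  (HahnSeries.embDomainRingHom (divNatHom D)
    (fun a b h => by
      have hD' : (D : ℚ) ≠ 0 := by exact_mod_cast hD
      have h' : (a : ℚ) / D = b / D := h
      rw [div_left_inj' hD'] at h'
      exact_mod_cast h')
    (fun a b => by
      have hD' : (0 : ℚ) < D := by exact_mod_cast Nat.pos_of_ne_zero hD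
      change (a : ℚ) / D ≤ b / D ↔ a ≤ b
      rw [div_le_div_iff_of_pos_right hD']
      exact Nat.cast_le)).comp (HahnSeries.toPowerSeries (R := ℂ)).symm.toRingHom

theorem support_hahnOfPowerSeries (D : ℕ) (hD : D ≠ 0) (f : PowerSeries ℂ) {q : ℚ}
    (hq : (hahnOfPowerSeries D hD f).coeff q ≠ 0) : ∃ k : ℕ, q = k / D := by
  by_contra h
  apply hq
  refine HahnSeries.embDomain_of_notMem_range ?_
  rintro ⟨k, hk⟩
  exact h ⟨k, hk.symm⟩

theorem coeff_hahnOfPowerSeries (D : ℕ) (hD : D ≠ 0) (f : PowerSeries ℂ) (k : ℕ) :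
    (hahnOfPowerSeries D hD f).coeff (k / D) = PowerSeries.coeff k f := by
  refine (HahnSeries.embDomain_coeff (a := k)).trans ?_
  exact HahnSeries.coeff_toPowerSeries_symm

/-- The embedding `X ↦ t ^ (1 / D)` of the power series into the Puiseux series. -/
def puiseuxOfPowerSeries (D : ℕ) (hD : D ≠ 0) : PowerSeries ℂ →+* Puiseux :=
  (hahnOfPowerSeries D hD).codRestrict Puiseux fun f =>
    ⟨D, Nat.pos_of_ne_zero hD, fun q hq => by
      obtain ⟨k, rfl⟩ := support_hahnOfPowerSeries D hD f hq
      have hD' : (D : ℚ) ≠ 0 := by exact_mod_cast hD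
      exact ⟨k, by rw [div_mul_cancel₀ _ hD']; simp⟩⟩

theorem puiseux_ext {p p' : Puiseux}
    (h : ∀ q, (p : HahnSeries ℚ ℂ).coeff q = (p' : HahnSeries ℚ ℂ).coeff q) : p = p' :=
  Subtype.ext (HahnSeries.ext (funext h))

theorem puiseuxOfPowerSeries_monomial (D : ℕ) (hD : D ≠ 0) (k : ℕ) (c : ℂ) :
    puiseuxOfPowerSeries D hD (PowerSeries.monomial k c) = puiseuxC c * puiseuxT (k / D) := by
  apply puiseux_ext
  intro q
  have hR : ((puiseuxC c * puiseuxT (k / D) : Puiseux) : HahnSeries ℚ ℂ) =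
      HahnSeries.single ((k : ℚ) / D) c := by
    change HahnSeries.C c * HahnSeries.single ((k : ℚ) / D) (1 : ℂ) = _
    rw [HahnSeries.C_apply, HahnSeries.single_mul_single, zero_add, mul_one]
  rw [hR]
  change (hahnOfPowerSeries D hD (PowerSeries.monomial k c)).coeff q = _
  have hD' : (D : ℚ) ≠ 0 := by exact_mod_cast hD
  by_cases hq : ∃ l : ℕ, q = l / D
  · obtain ⟨l, rfl⟩ := hq
    rw [coeff_hahnOfPowerSeries, PowerSeries.coeff_monomial, HahnSeries.coeff_single]
    simp only [div_left_inj' hD', Nat.cast_inj]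
  · rw [HahnSeries.coeff_single_of_ne (fun h => hq ⟨k, h⟩)]
    by_contra h
    exact hq (support_hahnOfPowerSeries D hD _ h)

theorem order_puiseuxOfPowerSeries (D : ℕ) (hD : D ≠ 0) (u : PowerSeries ℂ)
    (hu : PowerSeries.constantCoeff u ≠ 0) :
    (puiseuxOfPowerSeries D hD u : HahnSeries ℚ ℂ) ≠ 0 ∧
      (puiseuxOfPowerSeries D hD u : HahnSeries ℚ ℂ).order = 0 := by
  have h0 : (puiseuxOfPowerSeries D hD u : HahnSeries ℚ ℂ).coeff 0 ≠ 0 := by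
    have := coeff_hahnOfPowerSeries D hD u 0
    rw [Nat.cast_zero, zero_div, PowerSeries.coeff_zero_eq_constantCoeff_apply] at this
    change (hahnOfPowerSeries D hD u).coeff 0 ≠ 0
    rwa [this]
  have hne : (puiseuxOfPowerSeries D hD u : HahnSeries ℚ ℂ) ≠ 0 := by
    intro h
    rw [h] at h0
    exact h0 rfl
  refine ⟨hne, le_antisymm (HahnSeries.order_le_of_coeff_ne_zero h0) ?_⟩
  change hahnOfPowerSeries D hD u ≠ 0 at hne
  obtain ⟨k, hk⟩ := support_hahnOfPowerSeries D hD u (HahnSeries.coeff_order_eq_zero.not.2 hne)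
  change 0 ≤ (hahnOfPowerSeries D hD u).order
  rw [hk]
  positivity

/-- Lifting of rational weights: the zero is sought in the form `x_i = t ^ q_i * y ^ m_i`, where `m`
separates the exponents of `g` and `y` has order `0`. Thus no terms of the initial form cancel under
the substitution, and its reduction keeps at least two terms. -/
theorem mem_ord_zeroSet_of_rational {n : ℕ} (g : MvPolynomial (Fin n) ℂ) (q : Fin n → ℚ)
    (h : MinAttainedTwice (g.support : Set (Fin n →₀ ℕ)) fun i => (q i : ℝ)) :
    (fun i => (q i : ℝ)) ∈ ord '' zeroSet g := by
  classical
  have hT0 : ∀ a, puiseuxT a ≠ 0 := fun a h0 => by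
    have := congrArg (fun p : Puiseux => (p : HahnSeries ℚ ℂ)) h0
    exact HahnSeries.single_ne_zero one_ne_zero this
  have hTord : ∀ a, (puiseuxT a : HahnSeries ℚ ℂ).order = a := fun a =>
    HahnSeries.order_single one_ne_zero
  rcases h with h0 | ⟨α, hα, β, hβ, hne, heq, hmin⟩
  · have hg : g = 0 := by
      rw [← MvPolynomial.support_eq_empty]
      exact_mod_cast h0
    refine ⟨fun i => puiseuxT (q i), ⟨fun i => hT0 _, ?_⟩, ?_⟩
    · rw [hg, MvPolynomial.eval₂_zero]
    · funext i
      rw [ord, hTord]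
  -- Common denominator of the weights.
  obtain ⟨N, hN, a, ha⟩ : ∃ N : ℕ, N ≠ 0 ∧ ∃ a : Fin n → ℤ, ∀ i, q i = a i / N := by
    refine ⟨∏ i, (q i).den, Finset.prod_ne_zero_iff.2 fun i _ => (q i).den_ne_zero,
      fun i => (q i).num * ∏ j ∈ Finset.univ.erase i, (q j).den, fun i => ?_⟩
    rw [← Finset.mul_prod_erase Finset.univ (fun j => (q j).den) (Finset.mem_univ i)]
    have h1 : (∏ j ∈ Finset.univ.erase i, ((q j).den : ℚ)) ≠ 0 :=
      Finset.prod_ne_zero_iff.2 fun j _ => by exact_mod_cast (q j).den_ne_zero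
    push_cast
    rw [mul_div_mul_right _ _ h1, Rat.num_div_den]
  have hN' : (0 : ℝ) < N := by exact_mod_cast Nat.pos_of_ne_zero hN
  set e : (Fin n →₀ ℕ) → ℤ := fun γ => ∑ i, a i * (γ i : ℤ) with he
  have hdot : ∀ γ, dotExp (fun i => (q i : ℝ)) γ = (e γ : ℝ) / N := by
    intro γ
    simp only [dotExp, he, ha]
    push_cast
    rw [Finset.sum_div]
    exact Finset.sum_congr rfl fun i _ => by ring
  have hele : ∀ γ ∈ g.support, e α ≤ e γ := by
    intro γ hγ
    have := hmin γ hγ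
    rw [hdot, hdot, div_le_div_iff_of_pos_right hN'] at this
    exact_mod_cast this
  have heeq : e α = e β := by
    rw [hdot, hdot, div_left_inj' hN'.ne'] at heq
    exact_mod_cast heq
  set E : (Fin n →₀ ℕ) → ℕ := fun γ => (e γ - e α).toNat with hE
  have hEc : ∀ γ ∈ g.support, (E γ : ℤ) = e γ - e α := fun γ hγ =>
    Int.toNat_of_nonneg (by linarith [hele γ hγ])
  obtain ⟨m, hm⟩ := exists_separating_weight g.support
  set μ : (Fin n →₀ ℕ) → ℕ := fun γ => ∑ i, m i * γ i with hμ
  -- `P` is `g (t ^ (a i) * Y ^ (m i))`, with `t = X`, divided by `t ^ e α`.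
  set P : Polynomial (PowerSeries ℂ) := ∑ γ ∈ g.support,
    Polynomial.monomial (μ γ) (PowerSeries.monomial (E γ) (g.coeff γ)) with hP
  have hPc : ∀ γ ∈ g.support, P.coeff (μ γ) = PowerSeries.monomial (E γ) (g.coeff γ) := by
    intro γ hγ
    rw [hP, Polynomial.finsetSum_coeff, Finset.sum_eq_single_of_mem γ hγ]
    · rw [Polynomial.coeff_monomial, if_pos rfl]
    · intro δ hδ hδγ
      rw [Polynomial.coeff_monomial, if_neg fun h => hδγ (hm hδ hγ h)]
  set Pb := P.map PowerSeries.constantCoeff with hPb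
  have hPbc : ∀ γ ∈ g.support, e γ = e α → Pb.coeff (μ γ) ≠ 0 := by
    intro γ hγ h
    have hE0 : E γ = 0 := by simp [hE, h]
    rw [hPb, Polynomial.coeff_map, hPc γ hγ, hE0, ← PowerSeries.coeff_zero_eq_constantCoeff_apply,
      PowerSeries.coeff_monomial_same]
    exact MvPolynomial.mem_support_iff.1 hγ
  have hμne : μ α ≠ μ β := fun h => hne (hm hα hβ h)
  obtain ⟨r, hr0, hr⟩ := exists_nonzero_root Pb hμne (hPbc α hα rfl) (hPbc β hβ heeq.symm)
  have hPb0 : Pb ≠ 0 := by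
    intro h
    exact hPbc α hα rfl (by rw [h, Polynomial.coeff_zero])
  have hT : Polynomial.taylor r Pb ≠ 0 := by rwa [Ne, Polynomial.taylor_eq_zero]
  have htay : (Polynomial.taylor (PowerSeries.C r) P).map PowerSeries.constantCoeff =
      Polynomial.taylor r Pb := by
    rw [Polynomial.taylor_apply, Polynomial.map_comp, Polynomial.taylor_apply]
    simp [hPb]
  obtain ⟨M, hM, z, hz, hz0⟩ := exists_puiseux_root (Polynomial.taylor r Pb).natTrailingDegree
    (Polynomial.taylor (PowerSeries.C r) P) (by
      rw [Nat.pos_iff_ne_zero]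
      intro h
      rw [Polynomial.natTrailingDegree_eq_zero, Polynomial.taylor_coeff_zero] at h
      exact h.elim hT (fun h => h hr))
    (fun i hi => by
      rw [← Polynomial.coeff_map, htay]
      exact Polynomial.coeff_eq_zero_of_lt_natTrailingDegree hi)
    (by
      rw [← Polynomial.coeff_map, htay]
      exact Polynomial.trailingCoeff_nonzero_iff_nonzero.2 hT)
  rw [eval₂_taylor, ramify_C] at hz0
  -- With `X = t ^ (1 / (M * N))`, the ramified variable `X ^ M` is `t ^ (1 / N)`.
  set u := z + PowerSeries.C r with hu
  have hu0 : PowerSeries.constantCoeff u ≠ 0 := by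
    rw [hu, map_add, hz, zero_add, PowerSeries.constantCoeff_C]
    exact hr0
  have hD : M * N ≠ 0 := mul_ne_zero hM hN
  set ψ := puiseuxOfPowerSeries (M * N) hD with hψ
  obtain ⟨hψne, hψord⟩ := order_puiseuxOfPowerSeries (M * N) hD u hu0
  have hψne' : ψ u ≠ 0 := fun h => hψne (by rw [← hψ, h]; rfl)
  have hram : ∀ k c, ramify M hM (PowerSeries.monomial k c) = PowerSeries.monomial (M * k) c :=
    fun k c => PowerSeries.expand_monomial _ _ _ _
  have hroot : ∑ γ ∈ g.support,
      puiseuxC (g.coeff γ) * puiseuxT ((e γ - e α : ℤ) / N) * ψ u ^ μ γ = 0 := by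
    have h := congrArg ψ hz0
    rw [hP, Polynomial.eval₂_finsetSum, map_sum, map_zero] at h
    rw [← h]
    refine Finset.sum_congr rfl fun γ hγ => ?_
    rw [Polynomial.eval₂_monomial, map_mul, map_pow, hram, hψ, puiseuxOfPowerSeries_monomial]
    congr 3
    rw [← hEc γ hγ]
    push_cast
    have hM' : (M : ℚ) ≠ 0 := by exact_mod_cast hM
    rw [mul_div_mul_left _ _ hM']
  refine ⟨fun i => puiseuxT (q i) * ψ u ^ m i, ⟨fun i => mul_ne_zero (hT0 _)
    (pow_ne_zero _ hψne'), ?_⟩, ?_⟩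
  · have hfac : MvPolynomial.eval₂ puiseuxC (fun i => puiseuxT (q i) * ψ u ^ m i) g =
        puiseuxT ((e α : ℚ) / N) * ∑ γ ∈ g.support,
          puiseuxC (g.coeff γ) * puiseuxT ((e γ - e α : ℤ) / N) * ψ u ^ μ γ := by
      rw [MvPolynomial.eval₂_eq', Finset.mul_sum]
      refine Finset.sum_congr rfl fun γ _ => ?_
      have h1 : ∏ i, (puiseuxT (q i) * ψ u ^ m i) ^ γ i =
          puiseuxT (∑ i, γ i * q i) * ψ u ^ μ γ := by
        rw [puiseuxT_sum, hμ, ← Finset.prod_pow_eq_pow_sum, ← Finset.prod_mul_distrib]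
        exact Finset.prod_congr rfl fun i _ => by rw [mul_pow, puiseuxT_pow, ← pow_mul]
      have h2 : ∑ i, (γ i : ℚ) * q i = (e α : ℚ) / N + ((e γ - e α : ℤ) : ℚ) / N := by
        rw [← add_div]
        push_cast
        rw [add_sub_cancel, he]
        push_cast
        rw [Finset.sum_div]
        exact Finset.sum_congr rfl fun i _ => by rw [ha i]; ring
      rw [h1, h2, puiseuxT_add]
      ring
    rw [hfac, hroot, mul_zero]
  · funext i
    have hc : ((puiseuxT (q i) * ψ u ^ m i : Puiseux) : HahnSeries ℚ ℂ) =
        (puiseuxT (q i) : HahnSeries ℚ ℂ) * (ψ u : HahnSeries ℚ ℂ) ^ m i := rfl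
    have hT' : (puiseuxT (q i) : HahnSeries ℚ ℂ) ≠ 0 := fun h => hT0 (q i) (Subtype.ext h)
    rw [ord, hc, HahnSeries.order_mul hT' (pow_ne_zero _ hψne), HahnSeries.order_pow, hψord,
      hTord, smul_zero, add_zero]

/-- **Kapranov's theorem** for polynomials with constant coefficients. -/
theorem closure_ord_zeroSet {n : ℕ} (g : MvPolynomial (Fin n) ℂ) :
    closure (ord '' zeroSet g) =
      {w | MinAttainedTwice (g.support : Set (Fin n →₀ ℕ)) w} := by
  have hfin : (g.support : Set (Fin n →₀ ℕ)).Finite := g.support.finite_toSet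
  apply Set.Subset.antisymm
  · refine closure_minimal ?_ (isClosed_minAttainedTwice hfin)
    rintro _ ⟨v, hv, rfl⟩
    exact minAttainedTwice_ord g hv
  · intro w hw
    refine closure_mono ?_ (mem_closure_rational_minAttainedTwice hfin hw)
    rintro _ ⟨h, q, rfl⟩
    exact mem_ord_zeroSet_of_rational g q h

/-! ### Tropical hypersurfaces -/

theorem dotExp_mono {n : ℕ} {w : Fin n → ℝ} (hw : w ∈ ULoc n) : Monotone (dotExp w) :=
  fun _ _ h => Finset.sum_le_sum fun i _ =>
    mul_le_mul_of_nonneg_left (Nat.cast_le.2 (h i)) (hw i)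

/-- By Dickson's lemma, local weights attain their minimum on every nonempty set of exponents. -/
theorem exists_dotExp_min {n : ℕ} {w : Fin n → ℝ} (hw : w ∈ ULoc n) {S : Set (Fin n →₀ ℕ)}
    (hS : S.Nonempty) : ∃ α ∈ S, ∀ β ∈ S, dotExp w α ≤ dotExp w β := by
  have hwf : (dotExp w '' S).IsWF :=
    ((Set.isPWO_of_wellQuasiOrderedLE S).image_of_monotone (dotExp_mono hw)).isWF
  obtain ⟨α, hα, h⟩ := hwf.min_mem (hS.image _)
  exact ⟨α, hα, fun β hβ => h.le.trans (hwf.min_le (hS.image _) ⟨β, hβ, rfl⟩)⟩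

open Classical in
theorem tropTerm_trop {n : ℕ} (f : MvPowerSeries (Fin n) ℂ) (w : Fin n → ℝ) (α : Fin n →₀ ℕ) :
    tropTerm (trop f) w α =
      if α ∈ supp f then Tropical.trop ((dotExp w α : ℝ) : WithTop ℝ) else 0 := by
  have h : ∏ i, Tropical.trop ((w i : ℝ) : WithTop ℝ) ^ α i =
      Tropical.trop ((dotExp w α : ℝ) : WithTop ℝ) := by
    apply Tropical.injective_untrop
    rw [untrop_prod, Tropical.untrop_trop, dotExp, WithTop.coe_sum]
    refine Finset.sum_congr rfl fun i _ => ?_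
    rw [Tropical.untrop_pow, Tropical.untrop_trop, ← WithTop.coe_nsmul, nsmul_eq_mul, mul_comm]
  have hc : MvPowerSeries.coeff α (trop f) = if MvPowerSeries.coeff α f = 0 then 0 else 1 := rfl
  rw [tropTerm, h, hc]
  by_cases h0 : MvPowerSeries.coeff α f = 0
  · simp [h0, supp]
  · simp [h0, supp]

theorem mem_tropHypersurface_trop {n : ℕ} (f : MvPowerSeries (Fin n) ℂ) (w : Fin n → ℝ) :
    w ∈ tropHypersurface (trop f) ↔ w ∈ ULoc n ∧ MinAttainedTwice (supp f) w := by
  classical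
  refine and_congr_right fun _ => ?_
  rcases (supp f).eq_empty_or_nonempty with h0 | ⟨δ, hδ⟩
  · refine iff_of_true (Or.inl ?_) (Or.inl h0)
    ext1 α
    exact if_pos (by simpa [supp] using Set.eq_empty_iff_forall_notMem.1 h0 α)
  have hF : trop f ≠ 0 := by
    intro h
    have h1 := congrArg (MvPowerSeries.coeff δ) h
    have hc : MvPowerSeries.coeff δ (trop f) = 1 := if_neg hδ
    rw [hc, map_zero] at h1
    exact one_ne_zero h1
  rw [MinAttainedTwice, or_iff_right hF, or_iff_right (Set.nonempty_iff_ne_empty.1 ⟨δ, hδ⟩)]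
  have hne0 : ∀ x : ℝ, Tropical.trop (x : WithTop ℝ) ≠ 0 := fun x h =>
    WithTop.coe_ne_top (congrArg Tropical.untrop h)
  have hinj : ∀ x y : ℝ, Tropical.trop (x : WithTop ℝ) = Tropical.trop (y : WithTop ℝ) ↔ x = y :=
    fun x y => Tropical.injective_trop.eq_iff.trans WithTop.coe_inj
  have hle : ∀ x y : ℝ, Tropical.trop (x : WithTop ℝ) ≤ Tropical.trop (y : WithTop ℝ) ↔ x ≤ y :=
    fun x y => WithTop.coe_le_coe
  simp only [tropTerm_trop]
  constructor
  · rintro ⟨α, β, hne, heq, hmin⟩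
    have hα : α ∈ supp f := by
      by_contra hα
      have := hmin δ
      rw [if_neg hα, if_pos hδ] at this
      exact hne0 _ (le_antisymm (Tropical.le_zero _) this)
    rw [if_pos hα] at heq hmin
    have hβ : β ∈ supp f := by
      by_contra hβ
      rw [if_neg hβ] at heq
      exact hne0 _ heq
    rw [if_pos hβ, hinj] at heq
    refine ⟨α, hα, β, hβ, hne, heq, fun γ hγ => ?_⟩
    have := hmin γ
    rwa [if_pos hγ, hle] at this
  · rintro ⟨α, hα, β, hβ, hne, heq, hmin⟩
    refine ⟨α, β, hne, ?_, fun γ => ?_⟩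
    · rw [if_pos hα, if_pos hβ, heq]
    · rw [if_pos hα]
      split_ifs with hγ
      · rw [hle]
        exact hmin γ hγ
      · exact Tropical.le_zero _

/-! ### Initial forms -/

/-- The initial form with a weight `k` known to be that of `f`; this avoids transport between the
graded pieces of `wei w f` and `k`. -/
theorem initialForm_eq {n : ℕ} (w : ULoc n) (f : MvPowerSeries (Fin n) ℂ) {k : ℝ}
    (hk : wei w.1 f = k) (hf : f ∈ filt w.1 k) :
    initialForm w f = DirectSum.of (fun k : ℝ => GrPiece w.1 k) k
      (Submodule.Quotient.mk ⟨f, hf⟩) := by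
  subst hk
  rfl

theorem wei_eq {n : ℕ} {w : Fin n → ℝ} {f : MvPowerSeries (Fin n) ℂ} {α : Fin n →₀ ℕ}
    (hα : α ∈ supp f) (hmin : ∀ β ∈ supp f, dotExp w α ≤ dotExp w β) :
    wei w f = dotExp w α := by
  refine IsLeast.csInf_eq ⟨⟨α, hα, rfl⟩, ?_⟩
  rintro _ ⟨β, hβ, rfl⟩
  exact hmin β hβ

theorem mem_supp_monomial {n : ℕ} {α β : Fin n →₀ ℕ} {c : ℂ} (hc : c ≠ 0) :
    β ∈ supp (MvPowerSeries.monomial α c) ↔ β = α := by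
  classical
  simp [supp, MvPowerSeries.coeff_monomial, hc]

theorem wei_monomial {n : ℕ} (w : Fin n → ℝ) (α : Fin n →₀ ℕ) {c : ℂ} (hc : c ≠ 0) :
    wei w (MvPowerSeries.monomial α c) = dotExp w α :=
  wei_eq ((mem_supp_monomial hc).2 rfl) fun β hβ => by rw [(mem_supp_monomial hc).1 hβ]

theorem isGrMonomial_initialForm_iff {n : ℕ} (w : ULoc n) (f : MvPowerSeries (Fin n) ℂ) :
    IsGrMonomial w (initialForm w f) ↔
      ∃ α ∈ supp f, ∀ β ∈ supp f, β ≠ α → dotExp w.1 α < dotExp w.1 β := by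
  classical
  have hmk : ∀ (k : ℝ) (g h : MvPowerSeries (Fin n) ℂ) (hg : g ∈ filt w.1 k) (hh : h ∈ filt w.1 k),
      (Submodule.Quotient.mk ⟨g, hg⟩ : GrPiece w.1 k) = Submodule.Quotient.mk ⟨h, hh⟩ ↔
        g - h ∈ filtGT w.1 k := by
    intro k g h hg hh
    rw [Submodule.Quotient.eq]
    rfl
  constructor
  · rintro ⟨α, c, hc, h⟩
    have hk := wei_monomial w.1 α hc
    have hmon : MvPowerSeries.monomial α c ∈ filt w.1 (dotExp w.1 α) :=
      hk ▸ mem_filt_wei w.2 _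
    rw [initialForm_eq w _ hk hmon] at h
    -- Otherwise the component of degree `dotExp w α` of the initial form of `f` is zero, while
    -- that of the monomial is not.
    have hf : wei w.1 f = dotExp w.1 α := by
      by_contra hne
      have h1 := congrArg (fun x : Gr w.1 => x (dotExp w.1 α)) h
      simp only [initialForm] at h1
      rw [DirectSum.of_eq_of_ne _ _ _ (Ne.symm hne), DirectSum.of_eq_same] at h1
      have h2 := (hmk _ 0 _ (zero_mem _) hmon).1 h1
      rw [zero_sub, neg_mem_iff] at h2
      exact lt_irrefl _ (h2 α ((mem_supp_monomial hc).2 rfl))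
    have hff : f ∈ filt w.1 (dotExp w.1 α) := hf ▸ mem_filt_wei w.2 _
    rw [initialForm_eq w f hf hff] at h
    have h2 := (hmk _ _ _ hff hmon).1 (DirectSum.of_injective (β := fun k : ℝ => GrPiece w.1 k) _ h)
    refine ⟨α, ?_, fun β hβ hne => ?_⟩
    · intro h0
      refine lt_irrefl _ (h2 α ?_)
      change MvPowerSeries.coeff α _ ≠ 0
      rw [map_sub, h0, MvPowerSeries.coeff_monomial_same, zero_sub, neg_ne_zero]
      exact hc
    · refine h2 β ?_
      change MvPowerSeries.coeff β _ ≠ 0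
      rw [map_sub, MvPowerSeries.coeff_monomial_ne hne, sub_zero]
      exact hβ
  · rintro ⟨α, hα, hlt⟩
    have hc : MvPowerSeries.coeff α f ≠ 0 := hα
    refine ⟨α, MvPowerSeries.coeff α f, hc, ?_⟩
    have hk := wei_monomial w.1 α hc
    have hmon : MvPowerSeries.monomial α (MvPowerSeries.coeff α f) ∈ filt w.1 (dotExp w.1 α) :=
      hk ▸ mem_filt_wei w.2 _
    have hf : wei w.1 f = dotExp w.1 α := wei_eq hα fun β hβ => by
      rcases eq_or_ne β α with rfl | h
      · exact le_rfl
      · exact (hlt β hβ h).le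
    have hff : f ∈ filt w.1 (dotExp w.1 α) := hf ▸ mem_filt_wei w.2 _
    rw [initialForm_eq w f hf hff, initialForm_eq w _ hk hmon, (hmk _ _ _ hff hmon).2]
    intro β hβ
    have hβ' : MvPowerSeries.coeff β
        (f - MvPowerSeries.monomial α (MvPowerSeries.coeff α f)) ≠ 0 := hβ
    rw [map_sub] at hβ'
    rcases eq_or_ne β α with rfl | h
    · rw [MvPowerSeries.coeff_monomial_same, sub_self] at hβ'
      exact absurd rfl hβ'
    · rw [MvPowerSeries.coeff_monomial_ne h, sub_zero] at hβ'
      exact hlt β hβ' h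

theorem minAttainedTwice_iff_not {n : ℕ} {w : Fin n → ℝ} (hw : w ∈ ULoc n)
    (S : Set (Fin n →₀ ℕ)) :
    MinAttainedTwice S w ↔ ¬ ∃ α ∈ S, ∀ β ∈ S, β ≠ α → dotExp w α < dotExp w β := by
  constructor
  · rintro (rfl | ⟨α, hα, β, hβ, hne, heq, hmin⟩) ⟨δ, hδ, h⟩
    · exact hδ
    · rcases eq_or_ne α δ with rfl | hαδ
      · exact (h β hβ hne.symm).ne heq
      · exact (h α hα hαδ).not_ge (hmin δ hδ)
  · intro h
    rcases S.eq_empty_or_nonempty with h0 | hne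
    · exact Or.inl h0
    · obtain ⟨α, hα, hmin⟩ := exists_dotExp_min hw hne
      push Not at h
      obtain ⟨β, hβ, hβα, hle⟩ := h α hα
      exact Or.inr ⟨α, hα, β, hβ, hβα.symm, (hmin β hβ).antisymm hle, hmin⟩

theorem mem_noMonomialSet_iff {n : ℕ} (I : Ideal (MvPowerSeries (Fin n) ℂ)) (w : Fin n → ℝ) :
    w ∈ noMonomialSet I ↔ w ∈ ULoc n ∧ ∀ f ∈ I, MinAttainedTwice (supp f) w := by
  constructor
  · rintro ⟨hw, h⟩
    refine ⟨hw, fun f hf => ?_⟩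
    rw [minAttainedTwice_iff_not hw]
    exact fun h' => h f hf ((isGrMonomial_initialForm_iff ⟨w, hw⟩ f).2 h')
  · rintro ⟨hw, h⟩
    refine ⟨hw, fun f hf h' => ?_⟩
    exact (minAttainedTwice_iff_not hw _).1 (h f hf) ((isGrMonomial_initialForm_iff ⟨w, hw⟩ f).1 h')

/-! ### Truncations -/

theorem stratum_subset_ULoc {n : ℕ} (lam : Finset (Fin n)) : stratum lam ⊆ ULoc n := by
  intro w hw i
  by_cases hi : i ∈ lam
  · exact (hw.1 i hi).ge
  · exact (hw.2 i hi).le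

open Classical in
theorem mem_stratum_zeros {n : ℕ} {w : Fin n → ℝ} (hw : w ∈ ULoc n) :
    w ∈ stratum (Finset.univ.filter fun i => w i = 0) := by
  constructor
  · intro i hi
    simpa using hi
  · intro i hi
    exact (hw i).lt_of_ne' (by simpa using hi)

theorem dotExp_eq_of_proj_eq {n : ℕ} {lam : Finset (Fin n)} {w : Fin n → ℝ} (hw : w ∈ stratum lam)
    {α β : Fin n →₀ ℕ} (h : proj lam α = proj lam β) : dotExp w α = dotExp w β := by
  refine Finset.sum_congr rfl fun i _ => ?_
  by_cases hi : i ∈ lam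
  · rw [hw.1 i hi, zero_mul, zero_mul]
  · have : α i = β i := DFunLike.congr_fun h ⟨i, hi⟩
    rw [this]

theorem dotExp_lt_of_proj_lt {n : ℕ} {lam : Finset (Fin n)} {w : Fin n → ℝ} (hw : w ∈ stratum lam)
    {α β : Fin n →₀ ℕ} (h : proj lam α < proj lam β) : dotExp w α < dotExp w β := by
  have hle : ∀ i ∉ lam, α i ≤ β i := fun i hi => h.le ⟨i, hi⟩
  obtain ⟨⟨j, hj⟩, hjlt⟩ : ∃ j, proj lam α j < proj lam β j := by
    by_contra hcon
    push Not at hcon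
    exact h.not_ge hcon
  refine Finset.sum_lt_sum (fun i _ => ?_) ⟨j, Finset.mem_univ j, ?_⟩
  · by_cases hi : i ∈ lam
    · rw [hw.1 i hi, zero_mul, zero_mul]
    · exact mul_le_mul_of_nonneg_left (Nat.cast_le.2 (hle i hi)) (hw.2 i hi).le
  · exact mul_lt_mul_of_pos_left (Nat.cast_lt.2 hjlt) (hw.2 j hj)

theorem mem_supp_phi {n : ℕ} (lam : Finset (Fin n)) (f : MvPowerSeries (Fin n) ℂ)
    (β : {i : Fin n // ¬ i ∈ lam} →₀ ℕ) :
    β ∈ supp (phi lam f) ↔ (fiber lam f β).Nonempty := by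
  classical
  have hcoeff : ∀ γ, MvPowerSeries.coeff γ (MvPowerSeries.coeff β (phi lam f)) =
      MvPowerSeries.coeff (Finsupp.piecewise γ β) f := fun γ => rfl
  constructor
  · intro h
    by_contra hne
    apply h
    ext γ
    rw [hcoeff, map_zero]
    by_contra hγ
    refine hne ⟨Finsupp.piecewise γ β, hγ, ?_⟩
    ext ⟨i, hi⟩
    simp [proj, Finsupp.piecewise, hi]
  · rintro ⟨α, hα, rfl⟩ h
    apply hα
    have h1 := congrArg (MvPowerSeries.coeff (Finsupp.subtypeDomain (fun i => i ∈ lam) α)) h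
    rw [hcoeff, map_zero] at h1
    have hα' : Finsupp.piecewise (Finsupp.subtypeDomain (fun i => i ∈ lam) α) (proj lam α) = α := by
      ext i
      by_cases hi : i ∈ lam <;> simp [proj, Finsupp.piecewise]
    rwa [hα'] at h1

theorem mem_expSet_of_min {n : ℕ} {lam : Finset (Fin n)} {w : Fin n → ℝ} (hw : w ∈ stratum lam)
    {f : MvPowerSeries (Fin n) ℂ} {α : Fin n →₀ ℕ} (hα : α ∈ supp f)
    (hmin : ∀ β ∈ supp f, dotExp w α ≤ dotExp w β) : α ∈ expSet lam f := by
  refine ⟨hα, (mem_supp_phi lam f _).2 ⟨α, hα, rfl⟩, ?_⟩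
  intro β hβ hle
  obtain ⟨γ, hγ, rfl⟩ := (mem_supp_phi lam f _).1 hβ
  by_contra hnot
  exact (dotExp_lt_of_proj_lt hw (lt_of_le_not_ge hle hnot)).not_ge (hmin γ hγ)

/-- A subset that meets the weight-minimizing part of `T`, in two elements if that part has two,
decides whether the minimum over `T` is attained twice. -/
theorem minAttainedTwice_iff_of_subset {n : ℕ} {w : Fin n → ℝ} (hw : w ∈ ULoc n)
    {S T : Set (Fin n →₀ ℕ)} (hST : S ⊆ T)
    (h1 : ∀ α ∈ T, (∀ γ ∈ T, dotExp w α ≤ dotExp w γ) → ∃ α' ∈ S, dotExp w α' = dotExp w α)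
    (h2 : ∀ α ∈ T, ∀ β ∈ T, α ≠ β → dotExp w α = dotExp w β →
      (∀ γ ∈ T, dotExp w α ≤ dotExp w γ) →
      ∃ α' ∈ S, ∃ β' ∈ S, α' ≠ β' ∧ dotExp w α' = dotExp w α ∧ dotExp w β' = dotExp w α) :
    MinAttainedTwice S w ↔ MinAttainedTwice T w := by
  rcases T.eq_empty_or_nonempty with rfl | hT
  · rw [Set.subset_empty_iff.1 hST]
  obtain ⟨δ, hδ, hδmin⟩ := exists_dotExp_min hw hT
  obtain ⟨δ', hδ', hδ'eq⟩ := h1 δ hδ hδmin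
  constructor
  · rintro (rfl | ⟨α, hα, β, hβ, hne, heq, hmin⟩)
    · exact hδ'.elim
    · exact Or.inr ⟨α, hST hα, β, hST hβ, hne, heq, fun γ hγ =>
        ((hmin δ' hδ').trans hδ'eq.le).trans (hδmin γ hγ)⟩
  · rintro (h | ⟨α, hα, β, hβ, hne, heq, hmin⟩)
    · exact absurd h hT.ne_empty
    · obtain ⟨α', hα', β', hβ', hne', ha, hb⟩ := h2 α hα β hβ hne heq hmin
      exact Or.inr ⟨α', hα', β', hβ', hne', ha.trans hb.symm, fun γ hγ =>
        ha.le.trans (hmin γ (hST hγ))⟩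

theorem supp_tilde {n : ℕ} (lam : Finset (Fin n)) (f : MvPowerSeries (Fin n) ℂ) :
    supp (tilde lam f) = expSet lam f := by
  classical
  ext α
  have hc : MvPowerSeries.coeff α (tilde lam f) =
    if α ∈ expSet lam f then MvPowerSeries.coeff α f else 0 := rfl
  change MvPowerSeries.coeff α (tilde lam f) ≠ 0 ↔ _
  rw [hc]
  split_ifs with h
  · exact iff_of_true h.1 h
  · simp [h]

theorem minAttainedTwice_supp_tilde_iff {n : ℕ} {lam : Finset (Fin n)} {w : Fin n → ℝ}
    (hw : w ∈ stratum lam) (f : MvPowerSeries (Fin n) ℂ) :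
    MinAttainedTwice (supp (tilde lam f)) w ↔ MinAttainedTwice (supp f) w := by
  rw [supp_tilde]
  refine minAttainedTwice_iff_of_subset (stratum_subset_ULoc lam hw) (fun α hα => hα.1) ?_ ?_
  · exact fun α hα hmin => ⟨α, mem_expSet_of_min hw hα hmin, rfl⟩
  · exact fun α hα β hβ hne heq hmin => ⟨α, mem_expSet_of_min hw hα hmin, β,
      mem_expSet_of_min hw hβ (fun γ hγ => heq ▸ hmin γ hγ), hne, rfl, heq.symm⟩

theorem minAttainedTwice_selection_iff {n : ℕ} {lam : Finset (Fin n)} {w : Fin n → ℝ}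
    (hw : w ∈ stratum lam) {f : MvPowerSeries (Fin n) ℂ} {A : Finset (Fin n →₀ ℕ)}
    (hA : IsSelection lam f A) :
    MinAttainedTwice (A : Set (Fin n →₀ ℕ)) w ↔ MinAttainedTwice (supp f) w := by
  have hrep : ∀ α ∈ expSet lam f, ∃ α' ∈ A, proj lam α' = proj lam α := by
    intro α hα
    have hne : ((A : Set (Fin n →₀ ℕ)) ∩ fiber lam f (proj lam α)).Nonempty := by
      rw [← Set.encard_pos, hA.2 _ hα.2]
      exact lt_min (by norm_num) (Set.encard_pos.2 ⟨α, hα.1, rfl⟩)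
    obtain ⟨α', h1, h2⟩ := hne
    exact ⟨α', h1, h2.2⟩
  refine minAttainedTwice_iff_of_subset (stratum_subset_ULoc lam hw)
    (fun α hα => (hA.1 hα).1) ?_ ?_
  · intro α hα hmin
    obtain ⟨α', h1, h2⟩ := hrep α (mem_expSet_of_min hw hα hmin)
    exact ⟨α', h1, dotExp_eq_of_proj_eq hw h2⟩
  · intro α hα β hβ hne heq hmin
    have hαE := mem_expSet_of_min hw hα hmin
    have hβE := mem_expSet_of_min hw hβ (fun γ hγ => heq ▸ hmin γ hγ)
    by_cases hp : proj lam α = proj lam β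
    · have htwo : (2 : ℕ∞) ≤ (fiber lam f (proj lam α)).encard := by
        rw [← Set.encard_pair hne]
        refine Set.encard_le_encard ?_
        rintro _ (rfl | rfl)
        · exact ⟨hα, rfl⟩
        · exact ⟨hβ, hp.symm⟩
      have h := hA.2 _ hαE.2
      rw [min_eq_left htwo] at h
      obtain ⟨α', β', hne', hpair⟩ := Set.encard_eq_two.1 h
      have ha : α' ∈ (A : Set (Fin n →₀ ℕ)) ∩ fiber lam f (proj lam α) := by
        rw [hpair]; exact Or.inl rfl
      have hb : β' ∈ (A : Set (Fin n →₀ ℕ)) ∩ fiber lam f (proj lam α) := by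
        rw [hpair]; exact Or.inr rfl
      exact ⟨α', ha.1, β', hb.1, hne', dotExp_eq_of_proj_eq hw ha.2.2,
        dotExp_eq_of_proj_eq hw hb.2.2⟩
    · obtain ⟨α', ha, ha'⟩ := hrep α hαE
      obtain ⟨β', hb, hb'⟩ := hrep β hβE
      refine ⟨α', ha, β', hb, ?_, dotExp_eq_of_proj_eq hw ha',
        (dotExp_eq_of_proj_eq hw hb').trans heq.symm⟩
      rintro rfl
      exact hp (ha'.symm.trans hb')

theorem support_partialSum {n : ℕ} {f : MvPowerSeries (Fin n) ℂ} {A : Finset (Fin n →₀ ℕ)}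
    (hA : (A : Set (Fin n →₀ ℕ)) ⊆ supp f) : (partialSum f A).support = A := by
  classical
  ext α
  rw [MvPolynomial.mem_support_iff, partialSum, MvPolynomial.coeff_sum]
  simp only [MvPolynomial.coeff_monomial, Finset.sum_ite_eq']
  split_ifs with h
  · exact iff_of_true (hA h) h
  · simp [h]

theorem supp_coe {n : ℕ} (g : MvPolynomial (Fin n) ℂ) :
    supp (g : MvPowerSeries (Fin n) ℂ) = g.support := by
  ext α
  simp [supp]

theorem minAttainedTwice_supp_of_no_monomial {n : ℕ} {I : Ideal (MvPowerSeries (Fin n) ℂ)}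
    (hI : ∀ (α : Fin n →₀ ℕ) (c : ℂ), c ≠ 0 → MvPowerSeries.monomial α c ∉ I)
    {w : Fin n → ℝ} (hw : w ∈ stratum Finset.univ) {f : MvPowerSeries (Fin n) ℂ} (hf : f ∈ I) :
    MinAttainedTwice (supp f) w := by
  classical
  have hw0 : ∀ α, dotExp w α = 0 := fun α =>
    Finset.sum_eq_zero fun i _ => by rw [hw.1 i (Finset.mem_univ i), zero_mul]
  rw [minAttainedTwice_iff_not (stratum_subset_ULoc _ hw)]
  rintro ⟨α, hα, h⟩
  apply hI α (MvPowerSeries.coeff α f) hα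
  convert hf using 1
  ext β
  rcases eq_or_ne β α with rfl | hβ
  · rw [MvPowerSeries.coeff_monomial_same]
  · rw [MvPowerSeries.coeff_monomial_ne hβ]
    by_contra h0
    have := h β (Ne.symm h0) hβ
    rw [hw0, hw0] at this
    exact lt_irrefl _ this

/-! ### Comparison of the five sets -/

/-- The strata cover the orthant, so a description of the condition on each stratum describes the
whole set. -/
theorem noMonomialSet_eq_iUnion {n : ℕ} {I : Ideal (MvPowerSeries (Fin n) ℂ)}
    {Z : Finset (Fin n) → MvPowerSeries (Fin n) ℂ → Set (Fin n → ℝ)}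
    (hZ : ∀ lam, ∀ f ∈ I, ∀ w ∈ stratum lam, w ∈ Z lam f ↔ MinAttainedTwice (supp f) w) :
    noMonomialSet I = ⋃ lam, (⋂ f ∈ I, Z lam f) ∩ stratum lam := by
  classical
  ext w
  rw [mem_noMonomialSet_iff]
  simp only [Set.mem_iUnion, Set.mem_inter_iff, Set.mem_iInter]
  constructor
  · rintro ⟨hw, h⟩
    exact ⟨_, fun f hf => (hZ _ f hf w (mem_stratum_zeros hw)).2 (h f hf), mem_stratum_zeros hw⟩
  · rintro ⟨lam, h, hw⟩
    exact ⟨stratum_subset_ULoc lam hw, fun f hf => (hZ lam f hf w hw).1 (h f hf)⟩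

theorem noMonomialSet_eq_hypersurfaceSet {n : ℕ} (I : Ideal (MvPowerSeries (Fin n) ℂ)) :
    noMonomialSet I = hypersurfaceSet I := by
  ext w
  simp only [mem_noMonomialSet_iff, hypersurfaceSet, Set.mem_iInter, mem_tropHypersurface_trop]
  exact ⟨fun h f hf => ⟨h.1, h.2 f hf⟩, fun h => ⟨(h 0 I.zero_mem).1, fun f hf => (h f hf).2⟩⟩

theorem noMonomialSet_eq_stratumTropSet {n : ℕ} {I : Ideal (MvPowerSeries (Fin n) ℂ)}
    {G : Finset (Fin n) → MvPowerSeries (Fin n) ℂ → MvPowerSeries (Fin n) ℂ}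
    (hG : ∀ lam, ∀ f ∈ I, ∀ w ∈ stratum lam,
      (MinAttainedTwice (supp (G lam f)) w ↔ MinAttainedTwice (supp f) w)) :
    noMonomialSet I = stratumTropSet G I :=
  noMonomialSet_eq_iUnion fun lam f hf w hw => by
    rw [mem_tropHypersurface_trop, and_iff_right (stratum_subset_ULoc lam hw), hG lam f hf w hw]

theorem noMonomialSet_eq_stratumOrdSet {n : ℕ} {I : Ideal (MvPowerSeries (Fin n) ℂ)}
    {G : Finset (Fin n) → MvPowerSeries (Fin n) ℂ → MvPolynomial (Fin n) ℂ}
    (hG : ∀ lam, ∀ f ∈ I, ∀ w ∈ stratum lam,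
      (MinAttainedTwice (G lam f).support w ↔ MinAttainedTwice (supp f) w)) :
    noMonomialSet I = stratumOrdSet G I :=
  noMonomialSet_eq_iUnion fun lam f hf w hw => by
    rw [closure_ord_zeroSet, Set.mem_ofPred_eq, hG lam f hf w hw]

theorem minAttainedTwice_zeroAtOrigin_iff {n : ℕ} {M : Type*} [Zero M]
    {I : Ideal (MvPowerSeries (Fin n) ℂ)}
    (hI : ∀ (α : Fin n →₀ ℕ) (c : ℂ), c ≠ 0 → MvPowerSeries.monomial α c ∉ I)
    {G : Finset (Fin n) → MvPowerSeries (Fin n) ℂ → M} {s : M → Set (Fin n →₀ ℕ)} (hs : s 0 = ∅)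
    (hG : ∀ lam, ∀ f ∈ I, ∀ w ∈ stratum lam,
      (MinAttainedTwice (s (G lam f)) w ↔ MinAttainedTwice (supp f) w))
    (lam : Finset (Fin n)) (f : MvPowerSeries (Fin n) ℂ) (hf : f ∈ I) (w : Fin n → ℝ)
    (hw : w ∈ stratum lam) :
    MinAttainedTwice (s (zeroAtOrigin G lam f)) w ↔ MinAttainedTwice (supp f) w := by
  unfold zeroAtOrigin
  split_ifs with h
  · subst h
    exact iff_of_true (Or.inl hs) (minAttainedTwice_supp_of_no_monomial hI hw hf)
  · exact hG lam f hf w hw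

end LocalTropical
end
theorem mainTheorem1 (n : ℕ) (I : Ideal (MvPowerSeries (Fin n) ℂ))
    (A : Finset (Fin n) → MvPowerSeries (Fin n) ℂ → Finset (Fin n →₀ ℕ))
    (hA : ∀ lam, ∀ f ∈ I, LocalTropical.IsSelection lam f (A lam f)) :
    -- the five subsets coincide
    (LocalTropical.noMonomialSet I = LocalTropical.hypersurfaceSet I ∧
      LocalTropical.noMonomialSet I =
        LocalTropical.stratumTropSet LocalTropical.tilde I ∧
      LocalTropical.noMonomialSet I =
        LocalTropical.stratumTropSet (LocalTropical.hatSeries A) I ∧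
      LocalTropical.noMonomialSet I = LocalTropical.localTropicalVariety A I) ∧
    -- they also coincide with the truncations at the origin set to zero, if `I` has no monomial
    ((∀ (α : Fin n →₀ ℕ) (c : ℂ), c ≠ 0 → MvPowerSeries.monomial α c ∉ I) →
      LocalTropical.noMonomialSet I =
        LocalTropical.stratumTropSet (LocalTropical.zeroAtOrigin LocalTropical.tilde) I ∧
      LocalTropical.noMonomialSet I =
        LocalTropical.stratumTropSet
          (LocalTropical.zeroAtOrigin (LocalTropical.hatSeries A)) I ∧
      LocalTropical.noMonomialSet I =
        LocalTropical.stratumOrdSet (LocalTropical.zeroAtOrigin (LocalTropical.hat A)) I) := by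
  open LocalTropical in
  have hsupport : ∀ lam, ∀ f ∈ I, (hat A lam f).support = A lam f := fun lam f hf =>
    support_partialSum fun α hα => ((hA lam f hf).1 hα).1
  have htilde : ∀ lam, ∀ f ∈ I, ∀ w ∈ stratum lam,
      (MinAttainedTwice (supp (tilde lam f)) w ↔ MinAttainedTwice (supp f) w) :=
    fun lam f _ w hw => minAttainedTwice_supp_tilde_iff hw f
  have hhat : ∀ lam, ∀ f ∈ I, ∀ w ∈ stratum lam,
      (MinAttainedTwice ((hat A lam f).support : Set (Fin n →₀ ℕ)) w ↔
        MinAttainedTwice (supp f) w) := fun lam f hf w hw => by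
    rw [hsupport lam f hf]
    exact minAttainedTwice_selection_iff hw (hA lam f hf)
  have hhatSeries : ∀ lam, ∀ f ∈ I, ∀ w ∈ stratum lam,
      (MinAttainedTwice (supp (hatSeries A lam f)) w ↔ MinAttainedTwice (supp f) w) :=
    fun lam f hf w hw => by
      rw [hatSeries, supp_coe]
      exact hhat lam f hf w hw
  have hsupp0 : supp (0 : MvPowerSeries (Fin n) ℂ) = ∅ :=
    Set.eq_empty_iff_forall_notMem.2 fun α h => h (map_zero _)
  refine ⟨⟨noMonomialSet_eq_hypersurfaceSet I, noMonomialSet_eq_stratumTropSet htilde,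
    noMonomialSet_eq_stratumTropSet hhatSeries, noMonomialSet_eq_stratumOrdSet hhat⟩,
    fun hI => ⟨?_, ?_, ?_⟩⟩
  · exact noMonomialSet_eq_stratumTropSet (minAttainedTwice_zeroAtOrigin_iff hI hsupp0 htilde)
  · exact noMonomialSet_eq_stratumTropSet (minAttainedTwice_zeroAtOrigin_iff hI hsupp0 hhatSeries)
  · exact noMonomialSet_eq_stratumOrdSet (minAttainedTwice_zeroAtOrigin_iff hI
      (s := fun g : MvPolynomial (Fin n) ℂ => (g.support : Set (Fin n →₀ ℕ))) (by simp) hhat)
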